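/- Let $2\le c\le 4$, put $a=\sqrt{2c-4}$ (so $a\le c/2$) and $$V_0(x)=\tfrac14\Big[\big(\tfrac c2+x\big)\ln\big(\tfrac c2+x\big)+\big(\tfrac c2-x\big)\ln\big(\tfrac c2-x\big)\Big],\qquad |x|\le \tfrac c2$$ (with $0\ln 0=0$). Consider the functional $$\mathcal E[\rho]=\frac12\int_{-c/2}^{c/2}\int_{-c/2}^{c/2}\rho(x)\rho(y)\ln|x-y|^{-1}\,dx\,dy+\int_{-c/2}^{c/2}\rho(x)V_0(x)\,dx$$ on the measurable densities $\rho$ on $[-c/2,c/2]$ with $0\le\rho\le\frac12$ almost everywhere and $\int_{-c/2}^{c/2}\rho(x)\,dx=1$. For $x\in\mathbb R$ let $$\rho_1(x)=\frac1{\pi^2}\,\mathrm{Re}\left[\sqrt{2c-4-x^2}\ \ \mathrm{p.v.}\!\!\int_{-a}^{a}\frac{\frac14\left(\ln\left(\frac c2+s\right)-\ln\left(\frac c2-s\right)\right)}{\sqrt{2c-4-s^2}\,(s-x)}\,ds\right],$$ where the square root in front is purely imaginary, so that $\rho_1(x)=0$, for $x^2>2c-4$, and where $\rho_1(\pm a)=0$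 by convention. Then the principal value integral exists for every $|x|<a$, and $\rho=\frac12-\rho_1$ is the minimizer of $\mathcal E$: it is admissible, $\mathcal E[\rho]\le\mathcal E[\sigma]$ for every admissible $\sigma$, and equality holds only if $\sigma=\rho$ almost everywhere on $[-c/2,c/2]$. Moreover $\rho_1\ge 0$, $\rho_1(x)\neq 0$ exactly for $|x|<a$, $\rho_1$ is integrable on $[-c/2,c/2]$, and $\int_{-c/2}^{c/2}\rho_1(x)\,dx=\frac{c-2}{2}$. -/

import Mathlib

open Real Set Filter Topology MeasureTheory

noncomputable section

namespace LimitDensity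

/-- The interval `[-c/2, c/2]` on which the densities live. -/
def domain (c : ℝ) : Set ℝ := Icc (-(c / 2)) (c / 2)

/-- The external potential
`V₀(x) = ¼ [(c/2 + x) ln (c/2 + x) + (c/2 - x) ln (c/2 - x)]` (with `0 ln 0 = 0`). -/
def potential (c x : ℝ) : ℝ :=
  1 / 4 * ((c / 2 + x) * log (c / 2 + x) + (c / 2 - x) * log (c / 2 - x))

/-- The functional
`½ ∫∫ ρ(x) ρ(y) ln |x - y|⁻¹ dx dy + ∫ ρ(x) V₀(x) dx`, all integrals over `[-c/2, c/2]`. -/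
def energy (c : ℝ) (ρ : ℝ → ℝ) : ℝ :=
  1 / 2 * (∫ x in domain c, ∫ y in domain c, ρ x * ρ y * log (|x - y|⁻¹)) +
    ∫ x in domain c, ρ x * potential c x

/-- The admissible densities: measurable functions on `[-c/2, c/2]` with `0 ≤ ρ ≤ 1/2` almost
everywhere and total mass `1`. Values outside `[-c/2, c/2]` are irrelevant. -/
structure IsAdmissible (c : ℝ) (ρ : ℝ → ℝ) : Prop where
  aemeasurable : AEMeasurable ρ (volume.restrict (domain c))
  nonneg : ∀ᵐ x ∂(volume.restrict (domain c)), 0 ≤ ρ x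
  le_half : ∀ᵐ x ∂(volume.restrict (domain c)), ρ x ≤ 1 / 2
  mass : ∫ x in domain c, ρ x = 1

/-- `ρ` is the minimizer of the functional: it is admissible, no admissible density has smaller
energy, and every admissible density with the same energy agrees with `ρ` almost everywhere. -/
structure IsTheMinimizer (c : ℝ) (ρ : ℝ → ℝ) : Prop where
  admissible : IsAdmissible c ρ
  minimal : ∀ σ : ℝ → ℝ, IsAdmissible c σ → energy c ρ ≤ energy c σ
  unique : ∀ σ : ℝ → ℝ, IsAdmissible c σ → energy c σ = energy c ρ →
    σ =ᵐ[volume.restrict (domain c)] ρ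

/-- The integral of `f` over `[-a, a]` with the `ε`-neighbourhood of `x` cut out. -/
def truncatedIntegral (f : ℝ → ℝ) (a x ε : ℝ) : ℝ :=
  ∫ s in {s ∈ Icc (-a) a | ε ≤ |s - x|}, f s

/-- The principal value integral of `f` over `[-a, a]`, with respect to the singularity at `x`,
exists and equals `L`. -/
structure HasPrincipalValue (f : ℝ → ℝ) (a x L : ℝ) : Prop where
  integrableOn : ∀ ε : ℝ, 0 < ε → IntegrableOn f {s ∈ Icc (-a) a | ε ≤ |s - x|}
  tendsto : Tendsto (truncatedIntegral f a x) (𝓝[>] 0) (𝓝 L)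

/-- The principal value integral of `f` over `[-a, a]` with respect to the singularity at `x`
(meaningful where `HasPrincipalValue f a x L` holds for some `L`). -/
def principalValue (f : ℝ → ℝ) (a x : ℝ) : ℝ :=
  limUnder (𝓝[>] (0 : ℝ)) (truncatedIntegral f a x)

/-- The end point `√(2c - 4)` of the support. -/
def endpoint (c : ℝ) : ℝ := √(2 * c - 4)

/-- The integrand `¼ (ln (c/2 + s) - ln (c/2 - s)) / (√(2c - 4 - s²) (s - x))`. -/
def integrand (c x s : ℝ) : ℝ :=
  1 / 4 * (log (c / 2 + s) - log (c / 2 - s)) / (√(2 * c - 4 - s ^ 2) * (s - x))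

/-- The density
`ρ₁(x) = π⁻² Re [ √(2c-4-x²) p.v.∫_{-√(2c-4)}^{√(2c-4)}
  ¼ (ln (c/2+s) - ln (c/2-s)) / (√(2c-4-s²) (s-x)) ds ]`.
The outer square root is the complex one: it is purely imaginary for `x² > 2c - 4`. -/
def rhoOne (c x : ℝ) : ℝ :=
  1 / π ^ 2 *
    ((((2 * c - 4 - x ^ 2 : ℝ) : ℂ) ^ (1 / 2 : ℂ)) *
      ((principalValue (integrand c x) (endpoint c) x : ℝ) : ℂ)).re

end LimitDensity

end

/-! Write `h = c/2` and `a = endpoint c`. The principal value can be evaluated in closed form,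
giving `ρ₁ = arcsinDensity h a` (`rhoOne_eq`). Subtracting the force at `x` removes the singularity,
since the remaining kernel `1/(√(a²-s²)(s-x))` has principal value zero. The regular part is a
parameter integral that Tonelli and an explicit arcsine antiderivative evaluate.

The closed form is a mixture of the arcsine laws on `(-r, r)`, `0 < r < a`, with weights that do not
depend on `a` (`lintegral_arcsinDensity_mul`). For `a = h` the mixture is the uniform density `1/4`,
whose logarithmic potential is `-V₀` up to a constant (`integral_logKernel`). So the effective
potential of `1/2 - ρ₁` is, up to a constant, the potential of `1/4 - ρ₁`, a mixture of arcsine laws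
with `a < r ≤ h`. The potential of each of these is constant on `[-r, r]` and no larger outside, by
Jensen's formula. Hence the effective potential equals a constant `l` on `[-a, a]` and is at most
`l` elsewhere (`exists_effectivePotential_le`).

Off `[-a, a]` the upper constraint is active, so an admissible competitor can only lower the density
there, and the first variation is nonnegative. The second variation is the logarithmic energy of a
difference of mean zero. It is a mixture of Gaussian energies (`two_mul_logEnergy`), each positive
definite by the exponential series and Weierstrass approximation. This gives minimality and
uniqueness (`energy_add_logEnergy_le`). -/

noncomputable section

namespace LimitDensity

open scoped ENNReal

/-! ### Calculus -/

/-- The fundamental theorem of calculus for a nonnegative derivative on an open interval: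
integrability is automatic. -/
lemma integral_Ioo_of_hasDerivAt_of_nonneg {g g' : ℝ → ℝ} {a b : ℝ} (hab : a ≤ b)
    (hcont : ContinuousOn g (Icc a b)) (hderiv : ∀ x ∈ Ioo a b, HasDerivAt g (g' x) x)
    (hnonneg : ∀ x ∈ Ioo a b, 0 ≤ g' x) :
    IntegrableOn g' (Ioo a b) ∧ ∫ x in Ioo a b, g' x = g b - g a := by
  have hint := intervalIntegral.integrableOn_deriv_of_nonneg hcont hderiv hnonneg
  refine ⟨hint.mono_set Ioo_subset_Ioc_self, ?_⟩
  rw [← integral_Ioc_eq_integral_Ioo, ← intervalIntegral.integral_of_le hab]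
  exact intervalIntegral.integral_eq_sub_of_hasDerivAt_of_le hab hcont hderiv
    ((intervalIntegrable_iff_integrableOn_Ioc_of_le hab).2 hint)

lemma lintegral_Ioo_of_hasDerivAt_of_nonneg {g g' : ℝ → ℝ} {a b : ℝ} (hab : a ≤ b)
    (hcont : ContinuousOn g (Icc a b)) (hderiv : ∀ x ∈ Ioo a b, HasDerivAt g (g' x) x)
    (hnonneg : ∀ x ∈ Ioo a b, 0 ≤ g' x) :
    ∫⁻ x in Ioo a b, ENNReal.ofReal (g' x) = ENNReal.ofReal (g b - g a) := by
  obtain ⟨h1, h2⟩ := integral_Ioo_of_hasDerivAt_of_nonneg hab hcont hderiv hnonneg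
  rw [← h2, ofReal_integral_eq_lintegral_ofReal h1]
  exact (ae_restrict_iff' measurableSet_Ioo).2 (ae_of_all _ hnonneg)

lemma one_sub_mul_sq_pos {k s : ℝ} (h : |k * s| < 1) : 0 < 1 - k ^ 2 * s ^ 2 := by
  have := (sq_lt_one_iff_abs_lt_one (k * s)).2 h
  nlinarith

/-- This antiderivative serves twice: with `(A, k) = (a, τ)` for the integral over `s`, and with
`(A, k) = (1/a, x)` for the integral over the parameter `τ`. -/
lemma hasDerivAt_arcsin_mul_div_sqrt {A k s : ℝ} (hA : 0 < A) (hkA : |k * A| < 1)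
    (hs : |s| < A) :
    HasDerivAt (fun s ↦ arcsin (√(1 - k ^ 2 * A ^ 2) * s / (A * √(1 - k ^ 2 * s ^ 2))))
      (√(1 - k ^ 2 * A ^ 2) / ((1 - k ^ 2 * s ^ 2) * √(A ^ 2 - s ^ 2))) s := by
  have hκ := one_sub_mul_sq_pos hkA
  have hs2 : s ^ 2 < A ^ 2 := sq_lt_sq' (abs_lt.1 hs).1 (abs_lt.1 hs).2
  have hd : 0 < 1 - k ^ 2 * s ^ 2 := by nlinarith [sq_nonneg k]
  set κ := √(1 - k ^ 2 * A ^ 2) with hκdef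
  set d := √(1 - k ^ 2 * s ^ 2) with hddef
  set q := √(A ^ 2 - s ^ 2) with hqdef
  have hq : 0 < q := sqrt_pos.2 (by linarith)
  have hdp : 0 < d := sqrt_pos.2 hd
  have hκ2 : κ ^ 2 = 1 - k ^ 2 * A ^ 2 := sq_sqrt hκ.le
  have hd2 : d ^ 2 = 1 - k ^ 2 * s ^ 2 := sq_sqrt hd.le
  have hq2 : q ^ 2 = A ^ 2 - s ^ 2 := sq_sqrt (by linarith)
  have key : 1 - (κ * s / (A * d)) ^ 2 = (q / (A * d)) ^ 2 := by
    field_simp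
    rw [hκ2, hd2, hq2]; ring
  have hpos : 0 < (q / (A * d)) ^ 2 := by positivity
  have hinner : HasDerivAt (fun s ↦ κ * s / (A * √(1 - k ^ 2 * s ^ 2))) (κ / (A * d ^ 3)) s := by
    have h1 : HasDerivAt (fun s : ℝ ↦ 1 - k ^ 2 * s ^ 2) (-(k ^ 2 * (2 * s))) s := by
      simpa using ((hasDerivAt_pow 2 s).const_mul (k ^ 2)).const_sub 1
    have h2 := (h1.sqrt hd.ne').const_mul A
    have h3 := ((hasDerivAt_id s).const_mul κ).div h2 (by positivity)
    convert! h3 using 1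
    simp only [id]
    rw [← hddef]
    field_simp
    rw [hd2]; ring
  have h := (hasDerivAt_arcsin (x := κ * s / (A * d)) (fun h ↦ by rw [h] at key; linarith)
    (fun h ↦ by rw [h] at key; linarith)).comp s hinner
  convert! h using 1
  rw [key, sqrt_sq (by positivity), ← hd2]
  field_simp

lemma continuousOn_arcsin_mul_div_sqrt {A k : ℝ} (hA : 0 < A) (hkA : |k * A| < 1) :
    ContinuousOn (fun s ↦ arcsin (√(1 - k ^ 2 * A ^ 2) * s / (A * √(1 - k ^ 2 * s ^ 2))))
      (Icc (-A) A) := by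
  refine continuous_arcsin.comp_continuousOn (ContinuousOn.div (by fun_prop) (by fun_prop) ?_)
  intro s hs
  have hκ := one_sub_mul_sq_pos hkA
  have hs2 : s ^ 2 ≤ A ^ 2 := sq_le_sq' hs.1 hs.2
  have hd : 0 < 1 - k ^ 2 * s ^ 2 := by nlinarith [sq_nonneg k]
  positivity

lemma integral_inv_mul_sqrt {A k : ℝ} (hA : 0 < A) (hkA : |k * A| < 1) :
    IntegrableOn (fun s ↦ 1 / ((1 - k ^ 2 * s ^ 2) * √(A ^ 2 - s ^ 2))) (Ioo (-A) A) ∧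
      ∫ s in Ioo (-A) A, 1 / ((1 - k ^ 2 * s ^ 2) * √(A ^ 2 - s ^ 2)) =
        π / √(1 - k ^ 2 * A ^ 2) := by
  have hκ : 0 < √(1 - k ^ 2 * A ^ 2) := sqrt_pos.2 (one_sub_mul_sq_pos hkA)
  obtain ⟨h1, h2⟩ := integral_Ioo_of_hasDerivAt_of_nonneg (neg_le_self hA.le)
    (continuousOn_arcsin_mul_div_sqrt hA hkA)
    (fun s hs ↦ hasDerivAt_arcsin_mul_div_sqrt hA hkA (abs_lt.2 hs)) (fun s hs ↦ by
      have hs2 : s ^ 2 < A ^ 2 := sq_lt_sq' hs.1 hs.2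
      have : 0 < 1 - k ^ 2 * s ^ 2 := by nlinarith [sq_nonneg k, one_sub_mul_sq_pos hkA]
      positivity)
  have heq : (fun s ↦ 1 / ((1 - k ^ 2 * s ^ 2) * √(A ^ 2 - s ^ 2))) = fun s ↦
      (√(1 - k ^ 2 * A ^ 2))⁻¹ *
        (√(1 - k ^ 2 * A ^ 2) / ((1 - k ^ 2 * s ^ 2) * √(A ^ 2 - s ^ 2))) := by
    ext s
    field_simp
  rw [heq]
  refine ⟨h1.const_mul _, ?_⟩
  rw [integral_const_mul, h2, neg_sq]
  have e1 : √(1 - k ^ 2 * A ^ 2) * A / (A * √(1 - k ^ 2 * A ^ 2)) = 1 := by field_simp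
  have e2 : √(1 - k ^ 2 * A ^ 2) * -A / (A * √(1 - k ^ 2 * A ^ 2)) = -1 := by field_simp
  rw [e1, e2, arcsin_one, arcsin_neg_one]
  field_simp
  ring

/-- Differentiating the closed form in its radius produces a multiple of the arcsine density `1/√(r²
- y²)`; this is the source of the mixture representation. -/
lemma hasDerivAt_arcsin_sqrt_div {h r y : ℝ} (hy : |y| < r) (hr : r < h) :
    HasDerivAt (fun r ↦ arcsin (√(r ^ 2 - y ^ 2) / √(h ^ 2 - y ^ 2)))
      (r / (√(h ^ 2 - r ^ 2) * √(r ^ 2 - y ^ 2))) r := by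
  have hr0 : 0 < r := (abs_nonneg y).trans_lt hy
  have h1 : y ^ 2 < r ^ 2 := sq_lt_sq' (abs_lt.1 hy).1 (abs_lt.1 hy).2
  have h2 : r ^ 2 < h ^ 2 := by gcongr
  have hd : HasDerivAt (fun r ↦ √(r ^ 2 - y ^ 2) / √(h ^ 2 - y ^ 2))
      (2 * r / (2 * √(r ^ 2 - y ^ 2)) / √(h ^ 2 - y ^ 2)) r := by
    have : HasDerivAt (fun r : ℝ ↦ r ^ 2 - y ^ 2) (2 * r) r := by
      simpa using (hasDerivAt_pow 2 r).sub_const (y ^ 2)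
    exact (this.sqrt (by linarith)).div_const _
  set p := √(r ^ 2 - y ^ 2) with hp
  set m := √(h ^ 2 - y ^ 2) with hm
  set q := √(h ^ 2 - r ^ 2) with hq
  have hp0 : 0 < p := sqrt_pos.2 (by linarith)
  have hm0 : 0 < m := sqrt_pos.2 (by linarith)
  have hq0 : 0 < q := sqrt_pos.2 (by linarith)
  have hp2 : p ^ 2 = r ^ 2 - y ^ 2 := sq_sqrt (by linarith)
  have hm2 : m ^ 2 = h ^ 2 - y ^ 2 := sq_sqrt (by linarith)
  have hq2 : q ^ 2 = h ^ 2 - r ^ 2 := sq_sqrt (by linarith)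
  have key : 1 - (p / m) ^ 2 = (q / m) ^ 2 := by
    field_simp
    rw [hp2, hm2, hq2]; ring
  have hpos : 0 < (q / m) ^ 2 := by positivity
  have hc := (hasDerivAt_arcsin (x := p / m) (fun h ↦ by rw [h] at key; linarith)
    (fun h ↦ by rw [h] at key; linarith)).comp r hd
  convert! hc using 1
  rw [key, sqrt_sq (by positivity)]
  field_simp

/-- The closed form `(2π)⁻¹ arcsin (√(a² - x²) / √(h² - x²))` of the density. -/
def arcsinDensity (h a x : ℝ) : ℝ := 1 / (2 * π) * arcsin (√(a ^ 2 - x ^ 2) / √(h ^ 2 - x ^ 2))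

lemma measurable_arcsinDensity (h a : ℝ) : Measurable (arcsinDensity h a) := by
  unfold arcsinDensity
  have := measurable_arcsin
  fun_prop

lemma arcsinDensity_nonneg (h a x : ℝ) : 0 ≤ arcsinDensity h a x :=
  mul_nonneg (by positivity) (arcsin_nonneg.2 (by positivity))

lemma arcsinDensity_le (h a x : ℝ) : arcsinDensity h a x ≤ 1 / 4 := by
  calc arcsinDensity h a x ≤ 1 / (2 * π) * (π / 2) := by
        unfold arcsinDensity
        gcongr
        exact arcsin_le_pi_div_two _
    _ = 1 / 4 := by field_simp; norm_num

lemma arcsinDensity_eq_zero {h a x : ℝ} (ha : 0 ≤ a) (hx : a ≤ |x|) : arcsinDensity h a x = 0 := by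
  have : a ^ 2 ≤ x ^ 2 := by rw [← sq_abs x]; gcongr
  simp [arcsinDensity, sqrt_eq_zero_of_nonpos (sub_nonpos.2 this)]

lemma arcsinDensity_pos {h a x : ℝ} (hah : a ≤ h) (hx : |x| < a) : 0 < arcsinDensity h a x := by
  have h1 : x ^ 2 < a ^ 2 := sq_lt_sq' (abs_lt.1 hx).1 (abs_lt.1 hx).2
  have h2 : a ^ 2 ≤ h ^ 2 := by have := (abs_nonneg x).trans hx.le; gcongr
  have : 0 < arcsin (√(a ^ 2 - x ^ 2) / √(h ^ 2 - x ^ 2)) :=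
    arcsin_pos.2 (div_pos (sqrt_pos.2 (by linarith)) (sqrt_pos.2 (by linarith)))
  unfold arcsinDensity
  positivity

/-- The extreme case `a = h` links the mixture to the external potential, which comes from a uniform
density. -/
lemma arcsinDensity_self {h x : ℝ} (hx : |x| < h) : arcsinDensity h h x = 1 / 4 := by
  have h1 : x ^ 2 < h ^ 2 := sq_lt_sq' (abs_lt.1 hx).1 (abs_lt.1 hx).2
  rw [arcsinDensity, div_self (sqrt_pos.2 (by linarith)).ne', arcsin_one]
  field_simp; norm_num

/-- The density as a mixture of arcsine densities. -/
lemma ofReal_arcsinDensity {h a y : ℝ} (hah : a ≤ h) (hy : |y| < a) :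
    ENNReal.ofReal (arcsinDensity h a y) = ∫⁻ r in Ioo |y| a,
      ENNReal.ofReal (1 / (2 * π) * (r / (√(h ^ 2 - r ^ 2) * √(r ^ 2 - y ^ 2)))) := by
  have hyh : y ^ 2 < h ^ 2 := sq_lt_sq' (abs_lt.1 (hy.trans_le hah)).1
    (abs_lt.1 (hy.trans_le hah)).2
  rw [lintegral_Ioo_of_hasDerivAt_of_nonneg
    (g := fun r ↦ 1 / (2 * π) * arcsin (√(r ^ 2 - y ^ 2) / √(h ^ 2 - y ^ 2))) hy.le]
  · simp [arcsinDensity]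
  · have : √(h ^ 2 - y ^ 2) ≠ 0 := (sqrt_pos.2 (by linarith)).ne'
    exact (continuousOn_const.mul (continuous_arcsin.comp_continuousOn (by fun_prop)))
  · intro r hr
    exact (hasDerivAt_arcsin_sqrt_div hr.1 (hr.2.trans_le hah)).const_mul _
  · intro r hr
    have : 0 < r := (abs_nonneg y).trans_lt hr.1
    positivity

/-! ### The principal value integral -/

/-- The derivative `¼ (ln (h + s) - ln (h - s))` of the external potential. -/
def force (h s : ℝ) : ℝ := 1 / 4 * (log (h + s) - log (h - s))

/-- The integrand of the principal value integral with its singularity removed. -/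
def regularIntegrand (h a x s : ℝ) : ℝ :=
  (force h s - force h x) / ((s - x) * √(a ^ 2 - s ^ 2))

lemma measurable_regularIntegrand (h a x : ℝ) : Measurable (regularIntegrand h a x) := by
  unfold regularIntegrand force
  fun_prop

/-- The integrand in a representation of `regularIntegrand` as an integral over a parameter. -/
def parameterIntegrand (a x s τ : ℝ) : ℝ :=
  1 / 2 * (1 + τ ^ 2 * (s * x)) / (1 - τ ^ 2 * x ^ 2) *
    (1 / ((1 - τ ^ 2 * s ^ 2) * √(a ^ 2 - s ^ 2)))

lemma abs_mul_lt_one_of_lt_inv {h a s τ : ℝ} (hah : a ≤ h) (hs : |s| < a)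
    (hτ : τ ∈ Ioo 0 (1 / h)) : |τ * s| < 1 := by
  have hh : 0 < h := (abs_nonneg s).trans_lt (hs.trans_le hah)
  rw [abs_mul, abs_of_pos hτ.1]
  calc τ * |s| ≤ 1 / h * |s| := by gcongr; exact hτ.2.le
    _ < 1 / h * h := by gcongr; exact hs.trans_le hah
    _ = 1 := by field_simp

lemma parameterIntegrand_nonneg {a x s τ : ℝ} (hs : |τ * s| < 1) (hx : |τ * x| < 1) :
    0 ≤ parameterIntegrand a x s τ := by
  have h1 := one_sub_mul_sq_pos hs
  have h2 := one_sub_mul_sq_pos hx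
  have h3 : |(τ * s) * (τ * x)| < 1 := by
    rw [abs_mul]
    calc |τ * s| * |τ * x| ≤ 1 * |τ * x| := by gcongr
      _ < 1 := by linarith
  have h4 : 0 < 1 + τ ^ 2 * (s * x) := by nlinarith [(abs_lt.1 h3).1]
  unfold parameterIntegrand
  positivity

/-- The differentiated function runs from `0` at `τ = 0` to `force h s` at `τ = 1/h`, so the force
becomes an integral of rational functions of `s`. -/
lemma hasDerivAt_log_sub_log {s τ : ℝ} (hs : |τ * s| < 1) :
    HasDerivAt (fun τ ↦ 1 / 4 * (log (1 + τ * s) - log (1 - τ * s)))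
      (1 / 2 * s / (1 - τ ^ 2 * s ^ 2)) τ := by
  have h1 : 0 < 1 + τ * s := by linarith [(abs_lt.1 hs).1]
  have h2 : 0 < 1 - τ * s := by linarith [(abs_lt.1 hs).2]
  have d1 : HasDerivAt (fun τ ↦ 1 + τ * s) s τ := by
    simpa using ((hasDerivAt_id τ).mul_const s).const_add 1
  have d2 : HasDerivAt (fun τ ↦ 1 - τ * s) (-s) τ := by
    simpa using ((hasDerivAt_id τ).mul_const s).const_sub 1
  convert! ((d1.log h1.ne').sub (d2.log h2.ne')).const_mul (1 / 4) using 1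
  have h3 : 1 - τ ^ 2 * s ^ 2 = (1 + τ * s) * (1 - τ * s) := by ring
  rw [h3, div_sub_div _ _ h1.ne' h2.ne', ← mul_div_assoc]
  congr 1
  ring

lemma log_sub_log_inv {h s : ℝ} (hs : |s| < h) :
    1 / 4 * (log (1 + 1 / h * s) - log (1 - 1 / h * s)) = force h s := by
  have hh : 0 < h := (abs_nonneg s).trans_lt hs
  have h1 : 0 < h + s := by linarith [(abs_lt.1 hs).1]
  have h2 : 0 < h - s := by linarith [(abs_lt.1 hs).2]
  rw [force, show 1 + 1 / h * s = (h + s) / h by field_simp,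
    show 1 - 1 / h * s = (h - s) / h by field_simp, log_div h1.ne' hh.ne', log_div h2.ne' hh.ne']
  ring

lemma continuousOn_log_sub_log {h s : ℝ} (hs : |s| < h) :
    ContinuousOn (fun τ ↦ 1 / 4 * (log (1 + τ * s) - log (1 - τ * s))) (Icc 0 (1 / h)) := by
  have hh : 0 < h := (abs_nonneg s).trans_lt hs
  have key : ∀ τ ∈ Icc 0 (1 / h), |τ * s| < 1 := fun τ hτ ↦ by
    rw [abs_mul, abs_of_nonneg hτ.1]
    calc τ * |s| ≤ 1 / h * |s| := by gcongr; exact hτ.2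
      _ < 1 / h * h := by gcongr
      _ = 1 := by field_simp
  exact fun τ hτ ↦ (hasDerivAt_log_sub_log (key τ hτ)).continuousAt.continuousWithinAt

/-- The factor `s - x` cancels under the parameter integral, because `s(1 - τ²x²) - x(1 - τ²s²) = (s
- x)(1 + τ²sx)`. -/
lemma lintegral_parameterIntegrand {h a x s : ℝ} (hah : a ≤ h) (hx : |x| < a) (hs : |s| < a)
    (hsx : s ≠ x) :
    ∫⁻ τ in Ioo 0 (1 / h), ENNReal.ofReal (parameterIntegrand a x s τ) =
      ENNReal.ofReal (regularIntegrand h a x s) := by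
  have hh : 0 < h := (abs_nonneg s).trans_lt (hs.trans_le hah)
  rw [lintegral_Ioo_of_hasDerivAt_of_nonneg
    (g := fun τ ↦ (1 / 4 * (log (1 + τ * s) - log (1 - τ * s)) -
      1 / 4 * (log (1 + τ * x) - log (1 - τ * x))) / ((s - x) * √(a ^ 2 - s ^ 2))) (by positivity)]
  · rw [log_sub_log_inv (hs.trans_le hah), log_sub_log_inv (hx.trans_le hah)]
    simp [regularIntegrand]
  · exact ((continuousOn_log_sub_log (hs.trans_le hah)).sub
      (continuousOn_log_sub_log (hx.trans_le hah))).div_const _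
  · intro τ hτ
    have h1 := abs_mul_lt_one_of_lt_inv hah hs hτ
    have h2 := abs_mul_lt_one_of_lt_inv hah hx hτ
    convert! ((hasDerivAt_log_sub_log h1).sub (hasDerivAt_log_sub_log h2)).div_const
      ((s - x) * √(a ^ 2 - s ^ 2)) using 1
    have h3 := (one_sub_mul_sq_pos h1).ne'
    have h4 := (one_sub_mul_sq_pos h2).ne'
    have h5 : s - x ≠ 0 := sub_ne_zero.2 hsx
    have h6 : √(a ^ 2 - s ^ 2) ≠ 0 :=
      (sqrt_pos.2 (sub_pos.2 (sq_lt_sq' (abs_lt.1 hs).1 (abs_lt.1 hs).2))).ne'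
    unfold parameterIntegrand
    rw [div_sub_div _ _ h3 h4, div_mul_div_comm, div_div, div_eq_div_iff (by positivity) (by positivity)]
    ring
  · intro τ hτ
    exact parameterIntegrand_nonneg (abs_mul_lt_one_of_lt_inv hah hs hτ)
      (abs_mul_lt_one_of_lt_inv hah hx hτ)

lemma integral_Ioo_of_odd {f : ℝ → ℝ} (a : ℝ) (hf : ∀ x, f (-x) = -f x) :
    ∫ x in Ioo (-a) a, f x = 0 := by
  rcases le_total a 0 with ha | ha
  · rw [Ioo_eq_empty (by linarith)]; simp
  rw [← integral_Ioc_eq_integral_Ioo, ← intervalIntegral.integral_of_le (neg_le_self ha)]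
  have := intervalIntegral.integral_comp_neg (a := -a) (b := a) f
  simp only [hf, neg_neg, intervalIntegral.integral_neg] at this
  linarith

/-- The summand with `τ² s x` is odd in `s` and drops out; the rest is `integral_inv_mul_sqrt`. -/
lemma lintegral_parameterIntegrand_left {h a x τ : ℝ} (hah : a ≤ h) (hx : |x| < a)
    (hτ : τ ∈ Ioo 0 (1 / h)) :
    ∫⁻ s in Ioo (-a) a, ENNReal.ofReal (parameterIntegrand a x s τ) =
      ENNReal.ofReal (π / 2 * (1 / ((1 - τ ^ 2 * x ^ 2) * √(1 - τ ^ 2 * a ^ 2)))) := by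
  have ha : 0 < a := (abs_nonneg x).trans_lt hx
  have hh : 0 < h := ha.trans_le hah
  have hτa : |τ * a| < 1 := by
    rw [abs_of_pos (mul_pos hτ.1 ha)]
    calc τ * a < 1 / h * a := by gcongr; exact hτ.2
      _ ≤ 1 / h * h := by gcongr
      _ = 1 := by field_simp
  obtain ⟨h1, h2⟩ := integral_inv_mul_sqrt ha hτa
  set k : ℝ → ℝ := fun s ↦ 1 / ((1 - τ ^ 2 * s ^ 2) * √(a ^ 2 - s ^ 2)) with hk
  have h3 : IntegrableOn (fun s ↦ s * k s) (Ioo (-a) a) := by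
    refine Integrable.bdd_mul (c := a) h1 (by fun_prop) ?_
    refine (ae_restrict_iff' measurableSet_Ioo).2 (ae_of_all _ fun s hs ↦ ?_)
    exact (abs_lt.2 hs).le
  have hodd : ∫ s in Ioo (-a) a, s * k s = 0 := integral_Ioo_of_odd a fun s ↦ by simp [hk]
  have heq : (fun s ↦ parameterIntegrand a x s τ) = fun s ↦
      1 / 2 / (1 - τ ^ 2 * x ^ 2) * k s + 1 / 2 * (τ ^ 2 * x) / (1 - τ ^ 2 * x ^ 2) * (s * k s) := by
    ext s
    simp only [parameterIntegrand, hk]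
    ring
  have hint : IntegrableOn (fun s ↦ parameterIntegrand a x s τ) (Ioo (-a) a) := by
    rw [heq]; exact (h1.const_mul _).add (h3.const_mul _)
  rw [← ofReal_integral_eq_lintegral_ofReal hint]
  · rw [heq, integral_add (h1.const_mul _) (h3.const_mul _), integral_const_mul,
      integral_const_mul, hodd, h2]
    congr 1
    rw [mul_zero, add_zero, div_div, div_mul_div_comm, div_mul_div_comm]
    ring
  · refine (ae_restrict_iff' measurableSet_Ioo).2 (ae_of_all _ fun s hs ↦ ?_)
    exact parameterIntegrand_nonneg (abs_mul_lt_one_of_lt_inv hah (abs_lt.2 hs) hτ)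
      (abs_mul_lt_one_of_lt_inv hah hx hτ)

lemma lintegral_parameter {h a x : ℝ} (hah : a ≤ h) (hx : |x| < a) :
    ∫⁻ τ in Ioo 0 (1 / h),
        ENNReal.ofReal (π / 2 * (1 / ((1 - τ ^ 2 * x ^ 2) * √(1 - τ ^ 2 * a ^ 2)))) =
      ENNReal.ofReal (π / (2 * √(a ^ 2 - x ^ 2)) *
        arcsin (√(a ^ 2 - x ^ 2) / √(h ^ 2 - x ^ 2))) := by
  have ha : 0 < a := (abs_nonneg x).trans_lt hx
  have hh : 0 < h := ha.trans_le hah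
  have hxa : |x * (1 / a)| < 1 := by
    rw [abs_mul, abs_of_pos (by positivity : 0 < 1 / a), mul_one_div]
    exact (div_lt_one ha).2 hx
  have hx2 : x ^ 2 < a ^ 2 := sq_lt_sq' (abs_lt.1 hx).1 (abs_lt.1 hx).2
  have hw : √(1 - x ^ 2 * (1 / a) ^ 2) = √(a ^ 2 - x ^ 2) / a := by
    rw [← sqrt_sq ha.le, ← sqrt_div' _ (by positivity), sqrt_sq ha.le]
    congr 1; field_simp
  have hwh : √(1 - x ^ 2 * (1 / h) ^ 2) = √(h ^ 2 - x ^ 2) / h := by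
    rw [← sqrt_sq hh.le, ← sqrt_div' _ (by positivity), sqrt_sq hh.le]
    congr 1; field_simp
  have hw0 : 0 < √(a ^ 2 - x ^ 2) := sqrt_pos.2 (by linarith)
  have h1a : 1 / h ≤ 1 / a := one_div_le_one_div_of_le ha hah
  rw [lintegral_Ioo_of_hasDerivAt_of_nonneg (g := fun τ ↦ π / (2 * √(a ^ 2 - x ^ 2)) *
      arcsin (√(1 - x ^ 2 * (1 / a) ^ 2) * τ / (1 / a * √(1 - x ^ 2 * τ ^ 2)))) (by positivity)]
  · congr 1
    simp only [mul_zero, zero_div, arcsin_zero, sub_zero]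
    congr 2
    rw [hw, hwh]
    field_simp
  · refine continuousOn_const.mul ((continuousOn_arcsin_mul_div_sqrt (by positivity) hxa).mono ?_)
    exact Icc_subset_Icc (by simp [ha.le]) h1a
  · intro τ hτ
    have hτa : |τ| < 1 / a := by rw [abs_of_pos hτ.1]; exact hτ.2.trans_le h1a
    convert! (hasDerivAt_arcsin_mul_div_sqrt (by positivity) hxa hτa).const_mul
      (π / (2 * √(a ^ 2 - x ^ 2))) using 1
    have hq : √((1 / a) ^ 2 - τ ^ 2) = √(1 - τ ^ 2 * a ^ 2) / a := by
      rw [← sqrt_sq ha.le, ← sqrt_div' _ (by positivity), sqrt_sq ha.le]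
      congr 1; field_simp
    rw [hw, hq, mul_comm (x ^ 2)]
    field_simp
  · intro τ hτ
    have := one_sub_mul_sq_pos (abs_mul_lt_one_of_lt_inv hah hx hτ)
    positivity

/-- The force is increasing, so its difference quotients are nonnegative. Integrability then follows
from the value of the lower integral. -/
lemma regularIntegrand_nonneg {h a x s : ℝ} (hx : |x| < h) (hs : |s| < h) :
    0 ≤ regularIntegrand h a x s := by
  have mono : ∀ {u v : ℝ}, |u| < h → |v| < h → u ≤ v → force h u ≤ force h v := by
    intro u v hu hv huv
    have h1 := log_le_log (by linarith [(abs_lt.1 hu).1]) (show h + u ≤ h + v by linarith)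
    have h2 := log_le_log (by linarith [(abs_lt.1 hv).2]) (show h - v ≤ h - u by linarith)
    unfold force
    linarith
  rw [regularIntegrand, ← div_div]
  refine div_nonneg ?_ (sqrt_nonneg _)
  rcases le_total x s with hxs | hxs
  · exact div_nonneg (sub_nonneg.2 (mono hx hs hxs)) (sub_nonneg.2 hxs)
  · exact div_nonneg_of_nonpos (sub_nonpos.2 (mono hs hx hxs)) (sub_nonpos.2 hxs)

lemma lintegral_regularIntegrand {h a x : ℝ} (hah : a ≤ h) (hx : |x| < a) :
    ∫⁻ s in Ioo (-a) a, ENNReal.ofReal (regularIntegrand h a x s) =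
      ENNReal.ofReal (π / (2 * √(a ^ 2 - x ^ 2)) *
        arcsin (√(a ^ 2 - x ^ 2) / √(h ^ 2 - x ^ 2))) := by
  have hswap := lintegral_lintegral_swap (μ := volume.restrict (Ioo (-a) a))
    (ν := volume.restrict (Ioo 0 (1 / h)))
    (f := fun s τ ↦ ENNReal.ofReal (parameterIntegrand a x s τ)) (by
      unfold parameterIntegrand; fun_prop)
  rw [setLIntegral_congr_fun (g := fun τ ↦
      ENNReal.ofReal (π / 2 * (1 / ((1 - τ ^ 2 * x ^ 2) * √(1 - τ ^ 2 * a ^ 2)))))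
      (s := Ioo 0 (1 / h)) measurableSet_Ioo
      fun τ hτ ↦ lintegral_parameterIntegrand_left hah hx hτ,
    lintegral_parameter hah hx] at hswap
  rw [← hswap]
  refine setLIntegral_congr_fun_ae measurableSet_Ioo ?_
  filter_upwards [compl_mem_ae_iff.2 (measure_singleton x)] with s hsx hs
  exact (lintegral_parameterIntegrand hah hx (abs_lt.2 hs) hsx).symm

lemma integral_regularIntegrand {h a x : ℝ} (hah : a ≤ h) (hx : |x| < a) :
    IntegrableOn (regularIntegrand h a x) (Ioo (-a) a) ∧
      ∫ s in Ioo (-a) a, regularIntegrand h a x s = π / (2 * √(a ^ 2 - x ^ 2)) *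
        arcsin (√(a ^ 2 - x ^ 2) / √(h ^ 2 - x ^ 2)) := by
  have hnn : 0 ≤ᵐ[volume.restrict (Ioo (-a) a)] regularIntegrand h a x :=
    (ae_restrict_iff' measurableSet_Ioo).2 (ae_of_all _ fun s hs ↦
      regularIntegrand_nonneg (hx.trans_le hah) ((abs_lt.2 hs).trans_le hah))
  have hm := (measurable_regularIntegrand h a x).aestronglyMeasurable
    (μ := volume.restrict (Ioo (-a) a))
  refine ⟨⟨hm, ?_⟩, ?_⟩
  · rw [hasFiniteIntegral_iff_ofReal hnn, lintegral_regularIntegrand hah hx]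
    exact ENNReal.ofReal_lt_top
  · rw [integral_eq_lintegral_of_nonneg_ae hnn hm, lintegral_regularIntegrand hah hx,
      ENNReal.toReal_ofReal]
    have := arcsin_nonneg.2 (show 0 ≤ √(a ^ 2 - x ^ 2) / √(h ^ 2 - x ^ 2) by positivity)
    positivity

/-- The interval `[-a, a]` with the `ε`-neighbourhood of `x` cut out. -/
def cutInterval (a x ε : ℝ) : Set ℝ := {s ∈ Icc (-a) a | ε ≤ |s - x|}

lemma measurableSet_cutInterval (a x ε : ℝ) : MeasurableSet (cutInterval a x ε) :=
  measurableSet_Icc.inter (measurableSet_le measurable_const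
    (by fun_prop : Measurable fun s ↦ |s - x|))

lemma cutInterval_subset (a x ε : ℝ) : cutInterval a x ε ⊆ Icc (-a) a := fun _ hs ↦ hs.1

lemma cutInterval_eq_union {a x ε : ℝ} (hε : 0 < ε) (h1 : -a < x - ε) (h2 : x + ε < a) :
    cutInterval a x ε = Icc (-a) (x - ε) ∪ Icc (x + ε) a := by
  ext s
  simp only [cutInterval, mem_ofPred_eq, mem_Icc, mem_union, le_abs]
  grind

/-- The singular kernel `1 / (√(a² - s²) (s - x))`. -/
def singularKernel (a x s : ℝ) : ℝ := 1 / (√(a ^ 2 - s ^ 2) * (s - x))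

lemma integrableOn_inv_sqrt (a : ℝ) : IntegrableOn (fun s ↦ 1 / √(a ^ 2 - s ^ 2)) (Icc (-a) a) := by
  rcases le_or_gt a 0 with ha | ha
  · refine IntegrableOn.mono_set (t := {a}) (by simp) fun s hs ↦ ?_
    simp only [mem_singleton_iff]
    linarith [hs.1, hs.2]
  rw [integrableOn_Icc_iff_integrableOn_Ioo]
  simpa using (integral_inv_mul_sqrt (k := 0) ha (by simp)).1

lemma integrableOn_singularKernel {a x ε : ℝ} (hε : 0 < ε) :
    IntegrableOn (singularKernel a x) (cutInterval a x ε) := by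
  have heq : singularKernel a x = fun s ↦ (s - x)⁻¹ * (1 / √(a ^ 2 - s ^ 2)) := by
    ext s; simp only [singularKernel, one_div, mul_inv]; ring
  rw [heq]
  refine Integrable.bdd_mul (c := 1 / ε)
    ((integrableOn_inv_sqrt a).mono_set (cutInterval_subset a x ε)) (by fun_prop) ?_
  refine (ae_restrict_iff' (measurableSet_cutInterval a x ε)).2 (ae_of_all _ fun s hs ↦ ?_)
  rw [norm_inv, Real.norm_eq_abs, ← one_div]
  exact one_div_le_one_div_of_le hε hs.2

/-- The argument of the logarithm in an antiderivative of `singularKernel`. -/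
def singularPrimitiveArg (a x s : ℝ) : ℝ := a ^ 2 - s * x + √(a ^ 2 - x ^ 2) * √(a ^ 2 - s ^ 2)

lemma singularPrimitiveArg_pos {a x s : ℝ} (hx : |x| < a) (hs : |s| ≤ a) :
    0 < singularPrimitiveArg a x s := by
  have ha : 0 < a := (abs_nonneg x).trans_lt hx
  have : s * x < a ^ 2 := by
    calc s * x ≤ |s * x| := le_abs_self _
      _ = |s| * |x| := abs_mul _ _
      _ ≤ a * |x| := by gcongr
      _ < a * a := by gcongr
      _ = a ^ 2 := by ring
  have h2 : 0 ≤ √(a ^ 2 - x ^ 2) * √(a ^ 2 - s ^ 2) := by positivity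
  unfold singularPrimitiveArg
  linarith

lemma continuous_singularPrimitiveArg (a x : ℝ) : Continuous (singularPrimitiveArg a x) := by
  unfold singularPrimitiveArg
  fun_prop

/-- An antiderivative of `singularKernel`. -/
def singularPrimitive (a x s : ℝ) : ℝ :=
  -(1 / √(a ^ 2 - x ^ 2)) * (log (singularPrimitiveArg a x s) - log (s - x))

lemma continuousOn_singularPrimitive {a x : ℝ} (hx : |x| < a) :
    ContinuousOn (singularPrimitive a x) (Icc (-a) a \ {x}) := by
  refine continuousOn_const.mul (ContinuousOn.sub ?_ ?_)
  · exact (continuous_singularPrimitiveArg a x).continuousOn.log fun s hs ↦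
      (singularPrimitiveArg_pos hx (abs_le.2 hs.1)).ne'
  · exact ContinuousOn.log (by fun_prop) fun s hs ↦ sub_ne_zero.2 hs.2

lemma hasDerivAt_singularPrimitive {a x s : ℝ} (hx : |x| < a) (hs : |s| < a) (hsx : s ≠ x) :
    HasDerivAt (singularPrimitive a x) (singularKernel a x s) s := by
  have hs2 : s ^ 2 < a ^ 2 := sq_lt_sq' (abs_lt.1 hs).1 (abs_lt.1 hs).2
  have hx2 : x ^ 2 < a ^ 2 := sq_lt_sq' (abs_lt.1 hx).1 (abs_lt.1 hx).2
  have hN := singularPrimitiveArg_pos hx hs.le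
  have hsx' : s - x ≠ 0 := sub_ne_zero.2 hsx
  set w := √(a ^ 2 - x ^ 2) with hw
  set q := √(a ^ 2 - s ^ 2) with hq
  have hw0 : 0 < w := sqrt_pos.2 (by linarith)
  have hq0 : 0 < q := sqrt_pos.2 (by linarith)
  have hw2 : w ^ 2 = a ^ 2 - x ^ 2 := sq_sqrt (by linarith)
  have hq2 : q ^ 2 = a ^ 2 - s ^ 2 := sq_sqrt (by linarith)
  have d1 : HasDerivAt (singularPrimitiveArg a x) (-x + w * (-(2 * s) / (2 * q))) s := by
    have e1 : HasDerivAt (fun s : ℝ ↦ a ^ 2 - s ^ 2) (-(2 * s)) s := by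
      simpa using (hasDerivAt_pow 2 s).const_sub (a ^ 2)
    have e2 := (e1.sqrt (by linarith)).const_mul w
    have e3 : HasDerivAt (fun s : ℝ ↦ a ^ 2 - s * x) (-x) s := by
      simpa using ((hasDerivAt_id s).mul_const x).const_sub (a ^ 2)
    exact e3.add e2
  have d2 : HasDerivAt (fun s ↦ s - x) 1 s := (hasDerivAt_id s).sub_const x
  convert! ((d1.log hN.ne').sub (d2.log hsx')).const_mul (-(1 / w)) using 1
  have hN' : singularPrimitiveArg a x s = a ^ 2 - s * x + w * q := rfl
  rw [div_sub_div _ _ hN.ne' hsx', singularKernel, ← hq]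
  -- The numerator is a multiple of the argument of the logarithm, which therefore cancels.
  have hnum : (-x + w * (-(2 * s) / (2 * q))) * (s - x) - singularPrimitiveArg a x s * 1 =
      -(w / q) * singularPrimitiveArg a x s := by
    rw [hN']
    field_simp
    linear_combination -w * hq2 + q * hw2
  rw [hnum]
  have := hN.ne'
  field_simp

/-- The antiderivative takes the same value at both end points, so the boundary terms at `±a`
cancel. -/
lemma singularPrimitive_right {a x : ℝ} (hx : |x| < a) :
    singularPrimitive a x a = -(1 / √(a ^ 2 - x ^ 2)) * log a := by
  have ha : 0 < a := (abs_nonneg x).trans_lt hx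
  have h1 : a - x ≠ 0 := by linarith [(abs_lt.1 hx).2]
  have : singularPrimitiveArg a x a = a * (a - x) := by
    simp only [singularPrimitiveArg, sub_self, sqrt_zero]; ring
  rw [singularPrimitive, this, log_mul ha.ne' h1]
  ring

lemma singularPrimitive_left {a x : ℝ} (hx : |x| < a) :
    singularPrimitive a x (-a) = -(1 / √(a ^ 2 - x ^ 2)) * log a := by
  have ha : 0 < a := (abs_nonneg x).trans_lt hx
  have h1 : -a - x ≠ 0 := by linarith [(abs_lt.1 hx).1]
  have : singularPrimitiveArg a x (-a) = -a * (-a - x) := by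
    simp only [singularPrimitiveArg, neg_sq, sub_self, sqrt_zero]; ring
  rw [singularPrimitive, this, log_mul (neg_ne_zero.2 ha.ne') h1, log_neg_eq_log]
  ring

lemma setIntegral_singularKernel {a x ε : ℝ} (hx : |x| < a) (hε : 0 < ε) (h1 : -a < x - ε)
    (h2 : x + ε < a) :
    ∫ s in cutInterval a x ε, singularKernel a x s = 1 / √(a ^ 2 - x ^ 2) *
      (log (singularPrimitiveArg a x (x + ε)) - log (singularPrimitiveArg a x (x - ε))) := by
  have hint := integrableOn_singularKernel (a := a) (x := x) hε
  rw [cutInterval_eq_union hε h1 h2] at hint ⊢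
  have hi1 := hint.mono_set subset_union_left
  have hi2 := hint.mono_set subset_union_right
  rw [setIntegral_union (Set.disjoint_left.2 fun s hs hs' ↦ by linarith [hs.2, hs'.1])
    measurableSet_Icc hi1 hi2, integral_Icc_eq_integral_Ioc, integral_Icc_eq_integral_Ioc,
    ← intervalIntegral.integral_of_le h1.le, ← intervalIntegral.integral_of_le h2.le,
    intervalIntegral.integral_eq_sub_of_hasDerivAt_of_le (f := singularPrimitive a x) h1.le,
    intervalIntegral.integral_eq_sub_of_hasDerivAt_of_le (f := singularPrimitive a x) h2.le,
    singularPrimitive_left hx, singularPrimitive_right hx]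
  -- Since `log (-ε) = log ε`, the divergent terms on the two sides of `x` cancel.
  · simp only [singularPrimitive, sub_sub_cancel_left, add_sub_cancel_left, log_neg_eq_log]
    ring
  · exact (continuousOn_singularPrimitive hx).mono fun s hs ↦
      ⟨⟨by linarith [hs.1], hs.2⟩, fun h ↦ by rw [mem_singleton_iff.1 h] at hs; linarith [hs.1]⟩
  · exact fun s hs ↦ hasDerivAt_singularPrimitive hx
      (abs_lt.2 ⟨by linarith [hs.1], hs.2⟩) (by linarith [hs.1] : x < s).ne'
  · exact (intervalIntegrable_iff_integrableOn_Icc_of_le h2.le).2 hi2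
  · exact (continuousOn_singularPrimitive hx).mono fun s hs ↦
      ⟨⟨hs.1, by linarith [hs.2]⟩, fun h ↦ by rw [mem_singleton_iff.1 h] at hs; linarith [hs.2]⟩
  · exact fun s hs ↦ hasDerivAt_singularPrimitive hx
      (abs_lt.2 ⟨hs.1, by linarith [hs.2]⟩) (by linarith [hs.2] : s < x).ne
  · exact (intervalIntegrable_iff_integrableOn_Icc_of_le h1.le).2 hi1

/-- The principal value of `singularKernel` vanishes. -/
lemma tendsto_setIntegral_singularKernel {a x : ℝ} (hx : |x| < a) :
    Tendsto (fun ε ↦ ∫ s in cutInterval a x ε, singularKernel a x s) (𝓝[>] 0) (𝓝 0) := by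
  have hN := (singularPrimitiveArg_pos hx hx.le).ne'
  have hcont : ContinuousAt (fun ε ↦ 1 / √(a ^ 2 - x ^ 2) *
      (log (singularPrimitiveArg a x (x + ε)) - log (singularPrimitiveArg a x (x - ε)))) 0 := by
    have hc := continuous_singularPrimitiveArg a x
    refine continuousAt_const.mul (ContinuousAt.sub ?_ ?_)
    · exact ContinuousAt.log (by fun_prop) (by simpa using hN)
    · exact ContinuousAt.log (by fun_prop) (by simpa using hN)
  have hlim := hcont.tendsto.mono_left (nhdsWithin_le_nhds (s := Ioi 0))
  simp only [add_zero, sub_zero, sub_self, mul_zero] at hlim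
  refine hlim.congr' ?_
  have hδ : 0 < a - |x| := sub_pos.2 hx
  filter_upwards [Ioo_mem_nhdsGT hδ] with ε hε
  exact (setIntegral_singularKernel hx hε.1 (by linarith [hε.2, neg_abs_le x])
    (by linarith [hε.2, le_abs_self x])).symm

lemma tendsto_setIntegral_cutInterval {f : ℝ → ℝ} {a x : ℝ} (hf : IntegrableOn f (Icc (-a) a)) :
    Tendsto (fun ε ↦ ∫ s in cutInterval a x ε, f s) (𝓝[>] 0) (𝓝 (∫ s in Icc (-a) a, f s)) := by
  have heq : ∀ ε, ∫ s in cutInterval a x ε, f s =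
      ∫ s in Icc (-a) a, (cutInterval a x ε).indicator f s := fun ε ↦ by
    rw [setIntegral_indicator (measurableSet_cutInterval a x ε),
      inter_eq_self_of_subset_right (cutInterval_subset a x ε)]
  simp only [heq]
  refine tendsto_integral_filter_of_dominated_convergence (fun s ↦ ‖f s‖) ?_ ?_ hf.norm ?_
  · exact Eventually.of_forall fun ε ↦
      hf.aestronglyMeasurable.indicator (measurableSet_cutInterval a x ε)
  · exact Eventually.of_forall fun ε ↦ ae_of_all _ fun s ↦ norm_indicator_le_norm_self _ _
  · rw [ae_restrict_iff' measurableSet_Icc]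
    filter_upwards [compl_mem_ae_iff.2 (measure_singleton x)] with s hsx hs
    refine tendsto_const_nhds.congr' ?_
    have hpos : 0 < |s - x| := abs_pos.2 (sub_ne_zero.2 hsx)
    filter_upwards [Ioo_mem_nhdsGT hpos] with ε hε
    rw [indicator_of_mem]
    exact ⟨hs, hε.2.le⟩

/-! ### Existence of the principal value and the closed form of `rhoOne` -/

lemma endpoint_sq {c : ℝ} (hc : 2 ≤ c) : endpoint c ^ 2 = 2 * c - 4 := sq_sqrt (by linarith)

lemma endpoint_nonneg (c : ℝ) : 0 ≤ endpoint c := sqrt_nonneg _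

lemma endpoint_le {c : ℝ} (hc : 2 ≤ c) : endpoint c ≤ c / 2 := by
  refine abs_le_of_sq_le_sq' ?_ (by linarith) |>.2
  rw [endpoint_sq hc]
  nlinarith [sq_nonneg (c / 2 - 2)]

/-- This perfect square is what makes the mass of `ρ₁` equal to `(c - 2)/2`; `c ≤ 4` decides the
sign of the root. -/
lemma sqrt_sq_sub_endpoint_sq {c : ℝ} (hc₂ : 2 ≤ c) (hc₄ : c ≤ 4) :
    √((c / 2) ^ 2 - endpoint c ^ 2) = 2 - c / 2 := by
  rw [endpoint_sq hc₂, show (c / 2) ^ 2 - (2 * c - 4) = (2 - c / 2) ^ 2 by ring,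
    sqrt_sq (by linarith)]

lemma integrand_eq {c : ℝ} (hc : 2 ≤ c) (x s : ℝ) :
    integrand c x s = regularIntegrand (c / 2) (endpoint c) x s +
      force (c / 2) x * singularKernel (endpoint c) x s := by
  simp only [integrand, regularIntegrand, singularKernel, force, endpoint_sq hc]
  ring

lemma hasPrincipalValue_integrand {c x : ℝ} (hc : 2 ≤ c) (hx : |x| < endpoint c) :
    HasPrincipalValue (integrand c x) (endpoint c) x
      (π / (2 * √(endpoint c ^ 2 - x ^ 2)) *
        arcsin (√(endpoint c ^ 2 - x ^ 2) / √((c / 2) ^ 2 - x ^ 2))) := by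
  obtain ⟨h1, h2⟩ := integral_regularIntegrand (endpoint_le hc) hx
  rw [← integrableOn_Icc_iff_integrableOn_Ioo] at h1
  rw [← integral_Icc_eq_integral_Ioo] at h2
  have hint : integrand c x = fun s ↦ regularIntegrand (c / 2) (endpoint c) x s +
      force (c / 2) x * singularKernel (endpoint c) x s := funext (integrand_eq hc x)
  have hi : ∀ ε : ℝ, 0 < ε →
      IntegrableOn (regularIntegrand (c / 2) (endpoint c) x) (cutInterval (endpoint c) x ε) :=
    fun ε _ ↦ h1.mono_set (cutInterval_subset _ _ _)
  have hs : ∀ ε : ℝ, 0 < ε → IntegrableOn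
      (fun s ↦ force (c / 2) x * singularKernel (endpoint c) x s) (cutInterval (endpoint c) x ε) :=
    fun ε hε ↦ (integrableOn_singularKernel hε).const_mul _
  constructor
  · intro ε hε
    rw [hint]
    exact (hi ε hε).add (hs ε hε)
  · have hlim := (tendsto_setIntegral_cutInterval (x := x) h1).add
      ((tendsto_setIntegral_singularKernel hx).const_mul (force (c / 2) x))
    rw [h2, mul_zero, add_zero] at hlim
    refine hlim.congr' ?_
    filter_upwards [self_mem_nhdsWithin] with ε hε
    rw [truncatedIntegral, hint]
    change _ = ∫ s in cutInterval (endpoint c) x ε, _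
    rw [integral_add (hi ε hε) (hs ε hε), integral_const_mul]

/-- For `t < 0` the complex root is purely imaginary, and its real part agrees with the default
value `0` of the real square root. -/
lemma re_cpow_half (t p : ℝ) : ((((t : ℝ) : ℂ) ^ (1 / 2 : ℂ)) * ((p : ℝ) : ℂ)).re = √t * p := by
  rw [Complex.re_mul_ofReal]
  congr 1
  rcases le_or_gt 0 t with ht | ht
  · rw [sqrt_eq_rpow, ← Complex.ofReal_re (t ^ (1 / 2 : ℝ)), Complex.ofReal_cpow ht]
    norm_num
  · rw [sqrt_eq_zero_of_nonpos ht.le, Complex.ofReal_cpow_of_nonpos ht.le]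
    rw [show (π : ℂ) * Complex.I * (1 / 2) = π / 2 * Complex.I by ring, Complex.exp_pi_div_two_mul_I]
    rw [Complex.mul_I_re, neg_eq_zero, ← Complex.ofReal_neg,
      show (1 / 2 : ℂ) = ((1 / 2 : ℝ) : ℂ) by norm_num,
      ← Complex.ofReal_cpow (by linarith), Complex.ofReal_im]

/-- The closed form of the density `ρ₁`. -/
theorem rhoOne_eq {c : ℝ} (hc : 2 ≤ c) : rhoOne c = arcsinDensity (c / 2) (endpoint c) := by
  ext x
  rw [rhoOne, re_cpow_half, ← endpoint_sq hc]
  rcases lt_or_ge |x| (endpoint c) with hx | hx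
  · have hx2 : x ^ 2 < endpoint c ^ 2 := sq_lt_sq' (abs_lt.1 hx).1 (abs_lt.1 hx).2
    have hw : 0 < √(endpoint c ^ 2 - x ^ 2) := sqrt_pos.2 (by linarith)
    rw [principalValue, (hasPrincipalValue_integrand hc hx).tendsto.limUnder_eq, arcsinDensity]
    field_simp
  -- Here `principalValue` may be a meaningless default, but it is multiplied by zero.
  · rw [arcsinDensity_eq_zero (endpoint_nonneg c) hx, sqrt_eq_zero_of_nonpos]
    · simp
    · rw [← sq_abs x]
      have := pow_le_pow_left₀ (endpoint_nonneg c) hx 2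
      linarith

/-! ### Mixtures of arcsine laws -/

lemma image_mul_cos_Ioo {r : ℝ} (hr : 0 < r) : (fun θ ↦ r * cos θ) '' Ioo 0 π = Ioo (-r) r := by
  ext y
  constructor
  · rintro ⟨θ, hθ, rfl⟩
    have h1 : cos θ < 1 := by
      simpa using cos_lt_cos_of_nonneg_of_le_pi le_rfl hθ.2.le hθ.1
    have h2 : -1 < cos θ := by
      simpa using cos_lt_cos_of_nonneg_of_le_pi hθ.1.le le_rfl hθ.2
    constructor <;> dsimp only <;> nlinarith
  · intro hy
    have h1 : -1 < y / r := by rw [lt_div_iff₀ hr]; linarith [hy.1]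
    have h2 : y / r < 1 := by rw [div_lt_iff₀ hr]; linarith [hy.2]
    refine ⟨arccos (y / r), ⟨arccos_pos.2 h2, ?_⟩, ?_⟩
    · rw [← arccos_neg_one]
      exact arccos_lt_arccos le_rfl h1 h2.le
    · simp only [cos_arccos h1.le h2.le]
      field_simp

/-- Integration against the (unnormalized) arcsine law on `(-r, r)`. -/
lemma lintegral_inv_sqrt_mul {r : ℝ} (hr : 0 < r) (f : ℝ → ℝ≥0∞) :
    ∫⁻ y in Ioo (-r) r, ENNReal.ofReal (1 / √(r ^ 2 - y ^ 2)) * f y =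
      ∫⁻ θ in Ioo 0 π, f (r * cos θ) := by
  rw [← image_mul_cos_Ioo hr, lintegral_image_eq_lintegral_abs_deriv_mul measurableSet_Ioo
    (f' := fun θ ↦ r * -sin θ)
    (fun θ _ ↦ ((hasDerivAt_cos θ).const_mul r).hasDerivWithinAt)]
  · refine setLIntegral_congr_fun measurableSet_Ioo fun θ hθ ↦ ?_
    have hs : 0 < sin θ := sin_pos_of_pos_of_lt_pi hθ.1 hθ.2
    have h1 : √(r ^ 2 - (r * cos θ) ^ 2) = r * sin θ := by
      rw [← sqrt_sq (by positivity : 0 ≤ r * sin θ)]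
      congr 1
      nlinarith [sin_sq_add_cos_sq θ]
    rw [h1, ← mul_assoc, ← ENNReal.ofReal_mul (abs_nonneg _), mul_neg, abs_neg,
      abs_of_pos (by positivity), mul_one_div_cancel (by positivity), ENNReal.ofReal_one, one_mul]
  · exact fun θ hθ φ hφ h ↦ injOn_cos ⟨hθ.1.le, hθ.2.le⟩ ⟨hφ.1.le, hφ.2.le⟩
      (mul_left_cancel₀ hr.ne' h)

/-- The weight of the arcsine law on `(-r, r)` in the mixture. -/
def mixtureWeight (h r : ℝ) : ℝ := 1 / (2 * π) * (r / √(h ^ 2 - r ^ 2))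

lemma measurable_mixtureWeight (h : ℝ) : Measurable (mixtureWeight h) := by
  unfold mixtureWeight
  fun_prop

lemma mixtureWeight_nonneg {h r : ℝ} (hr : 0 ≤ r) : 0 ≤ mixtureWeight h r := by
  unfold mixtureWeight
  positivity

/-- The joint density of the radius and the position in the mixture. -/
def mixtureKernel (h y r : ℝ) : ℝ≥0∞ :=
  {p : ℝ × ℝ | |p.1| < p.2}.indicator
    (fun p ↦ ENNReal.ofReal (mixtureWeight h p.2) * ENNReal.ofReal (1 / √(p.2 ^ 2 - p.1 ^ 2))) (y, r)

lemma measurable_mixtureKernel (h : ℝ) : Measurable (Function.uncurry (mixtureKernel h)) := by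
  have := measurable_mixtureWeight h
  have hm : Measurable fun p : ℝ × ℝ ↦
      ENNReal.ofReal (mixtureWeight h p.2) * ENNReal.ofReal (1 / √(p.2 ^ 2 - p.1 ^ 2)) := by
    fun_prop
  exact hm.indicator (measurableSet_lt (by fun_prop : Measurable fun p : ℝ × ℝ ↦ |p.1|)
    measurable_snd)

lemma ofReal_arcsinDensity_eq_lintegral {h a : ℝ} (ha : 0 ≤ a) (hah : a ≤ h) (y : ℝ) :
    ENNReal.ofReal (arcsinDensity h a y) = ∫⁻ r in Ioo 0 a, mixtureKernel h y r := by
  have hind : ∀ r, mixtureKernel h y r = (Ioi |y|).indicator (fun r ↦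
      ENNReal.ofReal (mixtureWeight h r) * ENNReal.ofReal (1 / √(r ^ 2 - y ^ 2))) r := fun r ↦ by
    simp only [mixtureKernel, indicator, mem_ofPred_eq, mem_Ioi]
  simp only [hind]
  rw [setLIntegral_indicator measurableSet_Ioi]
  have hset : Ioi |y| ∩ Ioo 0 a = Ioo |y| a := by
    ext r
    simp only [mem_inter_iff, mem_Ioi, mem_Ioo]
    exact ⟨fun h ↦ ⟨h.1, h.2.2⟩, fun h ↦ ⟨h.1, (abs_nonneg y).trans_lt h.1, h.2⟩⟩
  rw [hset]
  rcases lt_or_ge |y| a with hy | hy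
  · rw [ofReal_arcsinDensity hah hy]
    refine setLIntegral_congr_fun measurableSet_Ioo fun r hr ↦ ?_
    rw [← ENNReal.ofReal_mul (mixtureWeight_nonneg ((abs_nonneg y).trans hr.1.le)), mixtureWeight,
      mul_assoc (1 / (2 * π)), div_mul_div_comm r, mul_one]
  · rw [arcsinDensity_eq_zero ha hy, Ioo_eq_empty (by linarith)]
    simp

/-- Tonelli for the mixture. On the right, `a` enters only through the range of `r`, so densities
with different `a` can be compared. -/
lemma lintegral_arcsinDensity_mul {h a : ℝ} (ha : 0 ≤ a) (hah : a ≤ h) {f : ℝ → ℝ≥0∞}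
    (hf : Measurable f) :
    ∫⁻ y in Icc (-h) h, ENNReal.ofReal (arcsinDensity h a y) * f y =
      ∫⁻ r in Ioo 0 a, ENNReal.ofReal (mixtureWeight h r) * ∫⁻ θ in Ioo 0 π, f (r * cos θ) := by
  have hK := measurable_mixtureKernel h
  simp only [ofReal_arcsinDensity_eq_lintegral ha hah]
  have h1 : ∀ y, (∫⁻ r in Ioo 0 a, mixtureKernel h y r) * f y =
      ∫⁻ r in Ioo 0 a, mixtureKernel h y r * f y := fun y ↦
    (lintegral_mul_const _ (hK.comp (measurable_const.prodMk measurable_id))).symm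
  simp only [h1]
  rw [lintegral_lintegral_swap (hK.mul (hf.comp measurable_fst)).aemeasurable]
  refine setLIntegral_congr_fun measurableSet_Ioo fun r hr ↦ ?_
  have hind : ∀ y, mixtureKernel h y r * f y = (Ioo (-r) r).indicator (fun y ↦
      ENNReal.ofReal (mixtureWeight h r) * (ENNReal.ofReal (1 / √(r ^ 2 - y ^ 2)) * f y)) y :=
    fun y ↦ by
      by_cases hy : |y| < r
      · rw [indicator_of_mem (show y ∈ Ioo (-r) r from abs_lt.1 hy), mixtureKernel, indicator_of_mem (by exact hy), mul_assoc]
      · rw [indicator_of_notMem (show y ∉ Ioo (-r) r from fun h ↦ hy (abs_lt.2 h)), mixtureKernel,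
          indicator_of_notMem (by exact hy), zero_mul]
  simp only [hind]
  rw [setLIntegral_indicator measurableSet_Ioo, inter_eq_self_of_subset_left,
    lintegral_const_mul _ (by fun_prop), lintegral_inv_sqrt_mul hr.1]
  exact Ioo_subset_Icc_self.trans (Icc_subset_Icc (by linarith [hr.2]) (by linarith [hr.2]))

lemma lintegral_arcsinDensity {h a : ℝ} (ha : 0 ≤ a) (hah : a ≤ h) :
    ∫⁻ y in Icc (-h) h, ENNReal.ofReal (arcsinDensity h a y) =
      ENNReal.ofReal (1 / 2 * (h - √(h ^ 2 - a ^ 2))) := by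
  have h1 := lintegral_arcsinDensity_mul ha hah (f := fun _ ↦ 1) measurable_const
  simp only [mul_one, setLIntegral_const, Real.volume_Ioo, sub_zero, one_mul] at h1
  rw [h1, show 1 / 2 * (h - √(h ^ 2 - a ^ 2)) =
    -(1 / 2) * √(h ^ 2 - a ^ 2) - -(1 / 2) * √(h ^ 2 - 0 ^ 2) by
      rw [zero_pow two_ne_zero, sub_zero, sqrt_sq (ha.trans hah)]; ring,
    ← lintegral_Ioo_of_hasDerivAt_of_nonneg (g := fun r ↦ -(1 / 2) * √(h ^ 2 - r ^ 2))
      (g' := fun r ↦ mixtureWeight h r * π) ha]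
  · exact setLIntegral_congr_fun measurableSet_Ioo fun r hr ↦
      (ENNReal.ofReal_mul (mixtureWeight_nonneg hr.1.le)).symm
  · fun_prop
  · intro r hr
    have hr2 : 0 < h ^ 2 - r ^ 2 := by nlinarith [hr.1, hr.2]
    have e1 : HasDerivAt (fun r : ℝ ↦ h ^ 2 - r ^ 2) (-(2 * r)) r := by
      simpa using (hasDerivAt_pow 2 r).const_sub (h ^ 2)
    convert! (e1.sqrt hr2.ne').const_mul (-(1 / 2)) using 1
    have := (sqrt_pos.2 hr2).ne'
    unfold mixtureWeight
    field_simp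
  · exact fun r hr ↦ mul_nonneg (mixtureWeight_nonneg hr.1.le) pi_nonneg

/-! ### The logarithmic potential of the arcsine law -/

/-- With `z = exp(iθ)` and `q = exp(iφ)`, `(z - q)(z - q⁻¹) = z(2 cos θ - 2 cos φ)`. A complex `φ`
also covers `|x| > r`. -/
lemma norm_mul_norm_circle {x r : ℝ} (hr : 0 < r) {φ : ℂ} (hφ : Complex.cos φ = x / r) (θ : ℝ) :
    ‖circleMap 0 1 θ - Complex.exp (φ * Complex.I)‖ *
      ‖circleMap 0 1 θ - Complex.exp (-φ * Complex.I)‖ = 2 / r * |x - r * cos θ| := by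
  set z := Complex.exp (θ * Complex.I) with hz
  set q := Complex.exp (φ * Complex.I) with hq
  set q' := Complex.exp (-φ * Complex.I) with hq'
  have hzm : circleMap 0 1 θ = z := by simp [circleMap, hz]
  have hqq : q * q' = 1 := by rw [hq, hq', ← Complex.exp_add]; simp
  have hsum : q + q' = 2 * (x / r) := by rw [← hφ, Complex.cos]; ring
  have hzz : z * Complex.exp (-θ * Complex.I) = 1 := by rw [hz, ← Complex.exp_add]; simp
  have hzsum : z + Complex.exp (-θ * Complex.I) = 2 * Complex.cos θ := by rw [Complex.cos]; ring
  have hr' : (r : ℂ) ≠ 0 := by exact_mod_cast hr.ne'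
  have key : (z - q) * (z - q') = z * ((2 / r * -(x - r * cos θ) : ℝ) : ℂ) := by
    push_cast
    have e1 : (2 / r * -(x - r * Complex.cos θ) : ℂ) = 2 * Complex.cos θ - 2 * (x / r) := by
      field_simp; ring
    rw [e1, ← hsum, ← hzsum]
    linear_combination hqq - hzz
  rw [hzm, ← norm_mul, key, norm_mul, hz, Complex.norm_exp_ofReal_mul_I, one_mul,
    Complex.norm_real, Real.norm_eq_abs, abs_mul, abs_neg, abs_of_pos (by positivity)]

lemma log_abs_sub_eq {x r : ℝ} (hr : 0 < r) {φ : ℂ} (hφ : Complex.cos φ = x / r) :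
    ∀ᵐ θ : ℝ, log |x - r * cos θ| = log (r / 2) +
      (log ‖circleMap 0 1 θ - Complex.exp (φ * Complex.I)‖ +
        log ‖circleMap 0 1 θ - Complex.exp (-φ * Complex.I)‖) := by
  have hc := Set.Countable.preimage_circleMap (s := {Complex.exp (φ * Complex.I),
    Complex.exp (-φ * Complex.I)}) (by simp) 0 one_ne_zero
  filter_upwards [hc.ae_notMem volume] with θ hθ
  simp only [mem_preimage, mem_insert_iff, mem_singleton_iff, not_or] at hθ
  have h1 : ‖circleMap 0 1 θ - Complex.exp (φ * Complex.I)‖ ≠ 0 :=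
    norm_ne_zero_iff.2 (sub_ne_zero.2 hθ.1)
  have h2 : ‖circleMap 0 1 θ - Complex.exp (-φ * Complex.I)‖ ≠ 0 :=
    norm_ne_zero_iff.2 (sub_ne_zero.2 hθ.2)
  rw [← log_mul h1 h2, ← log_mul (by positivity) (mul_ne_zero h1 h2),
    norm_mul_norm_circle hr hφ]
  congr 1
  field_simp

/-- Jensen's formula gives the mean of `log ‖z - q‖` over the unit circle as `log⁺ ‖q‖`; the
symmetry `θ ↦ 2π - θ` halves the circle. -/
lemma integral_log_abs_sub {x r : ℝ} (hr : 0 < r) {φ : ℂ} (hφ : Complex.cos φ = x / r) :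
    IntegrableOn (fun θ ↦ log |x - r * cos θ|) (Ioo 0 π) ∧
      ∫ θ in Ioo 0 π, log |x - r * cos θ| = π * (log (r / 2) +
        (log⁺ ‖Complex.exp (φ * Complex.I)‖ + log⁺ ‖Complex.exp (-φ * Complex.I)‖)) := by
  set q := Complex.exp (φ * Complex.I)
  set q' := Complex.exp (-φ * Complex.I)
  have hae := log_abs_sub_eq hr hφ
  have i1 : IntervalIntegrable (fun θ ↦ log ‖circleMap 0 1 θ - q‖) volume 0 (2 * π) :=
    circleIntegrable_log_norm_sub_const 1
  have i2 : IntervalIntegrable (fun θ ↦ log ‖circleMap 0 1 θ - q'‖) volume 0 (2 * π) :=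
    circleIntegrable_log_norm_sub_const 1
  have a1 := circleAverage_log_norm_sub_const_eq_posLog (a := q)
  have a2 := circleAverage_log_norm_sub_const_eq_posLog (a := q')
  rw [circleAverage_def, smul_eq_mul, inv_mul_eq_iff_eq_mul₀ (by positivity)] at a1 a2
  have hint : IntervalIntegrable (fun θ ↦ log |x - r * cos θ|) volume 0 (2 * π) := by
    exact (intervalIntegrable_const.add (i1.add i2)).congr_ae
      (ae_restrict_of_ae (hae.mono fun θ h ↦ h.symm))
  have hfull : ∫ θ in 0..2 * π, log |x - r * cos θ| =
      2 * π * (log (r / 2) + (log⁺ ‖q‖ + log⁺ ‖q'‖)) := by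
    rw [intervalIntegral.integral_congr_ae (hae.mono fun θ h _ ↦ h),
      intervalIntegral.integral_add intervalIntegrable_const (i1.add i2),
      intervalIntegral.integral_add i1 i2, a1, a2, intervalIntegral.integral_const]
    simp only [sub_zero, smul_eq_mul]
    ring
  have hp := pi_pos
  have h1 : IntervalIntegrable (fun θ ↦ log |x - r * cos θ|) volume 0 π :=
    hint.mono_set (uIcc_subset_uIcc_left (by rw [uIcc_of_le (by positivity)]; constructor <;> linarith))
  have h2 : IntervalIntegrable (fun θ ↦ log |x - r * cos θ|) volume π (2 * π) :=
    hint.mono_set (uIcc_subset_uIcc_right (by rw [uIcc_of_le (by positivity)]; constructor <;> linarith))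
  have hsplit := intervalIntegral.integral_add_adjacent_intervals h1 h2
  have hrefl := intervalIntegral.integral_comp_sub_left (a := 0) (b := π)
    (fun θ ↦ log |x - r * cos θ|) (2 * π)
  simp only [cos_two_pi_sub, sub_zero, show 2 * π - π = π by ring] at hrefl
  refine ⟨((intervalIntegrable_iff_integrableOn_Ioc_of_le hp.le).1 h1).mono_set
    Ioo_subset_Ioc_self, ?_⟩
  rw [← integral_Ioc_eq_integral_Ioo, ← intervalIntegral.integral_of_le hp.le]
  linarith

/-- The logarithmic kernel, shifted so as to be nonnegative at distances up to `4`. -/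
def logKernel (x y : ℝ) : ℝ := log 4 - log |x - y|

lemma measurable_logKernel : Measurable (Function.uncurry logKernel) := by
  unfold logKernel Function.uncurry
  have : Measurable fun p : ℝ × ℝ ↦ |p.1 - p.2| := by fun_prop
  fun_prop

lemma logKernel_nonneg {x y : ℝ} (hx : |x| ≤ 2) (hy : |y| ≤ 2) : 0 ≤ logKernel x y := by
  refine sub_nonneg.2 ?_
  rcases (abs_nonneg (x - y)).eq_or_lt with h | h
  · rw [← h, log_zero]
    exact log_nonneg (by norm_num)
  · exact log_le_log h ((abs_sub x y).trans (by linarith))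

lemma lintegral_logKernel_mul_cos {x r : ℝ} (hx : |x| ≤ 2) (hr : 0 < r) (hr2 : r ≤ 2) {φ : ℂ}
    (hφ : Complex.cos φ = x / r) :
    ∫⁻ θ in Ioo 0 π, ENNReal.ofReal (logKernel x (r * cos θ)) =
      ENNReal.ofReal (π * (log 4 - (log (r / 2) +
        (log⁺ ‖Complex.exp (φ * Complex.I)‖ + log⁺ ‖Complex.exp (-φ * Complex.I)‖)))) := by
  obtain ⟨h1, h2⟩ := integral_log_abs_sub hr hφ
  have hc : IntegrableOn (fun _ : ℝ ↦ log 4) (Ioo 0 π) := by simp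
  unfold logKernel
  have hi : IntegrableOn (fun θ ↦ log 4 - log |x - r * cos θ|) (Ioo 0 π) := hc.sub h1
  rw [← ofReal_integral_eq_lintegral_ofReal hi, integral_sub hc h1, h2]
  · congr 1
    rw [setIntegral_const, Real.volume_real_Ioo_of_le pi_nonneg, smul_eq_mul]
    ring
  · refine ae_of_all _ fun θ ↦ logKernel_nonneg hx ?_
    rw [abs_mul, abs_of_pos hr]
    calc r * |cos θ| ≤ 2 * 1 := by gcongr; exact abs_cos_le_one θ
      _ = 2 := by norm_num

lemma lintegral_logKernel_mul_cos_le {x r : ℝ} (hx : |x| ≤ 2) (hr : 0 < r) (hr2 : r ≤ 2) :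
    ∫⁻ θ in Ioo 0 π, ENNReal.ofReal (logKernel x (r * cos θ)) ≤
      ENNReal.ofReal (π * (log 4 - log (r / 2))) := by
  obtain ⟨φ, hφ⟩ := Complex.cos_surjective (x / r)
  rw [lintegral_logKernel_mul_cos hx hr hr2 hφ]
  have h1 : 0 ≤ log⁺ ‖Complex.exp (φ * Complex.I)‖ := posLog_nonneg
  have h2 : 0 ≤ log⁺ ‖Complex.exp (-φ * Complex.I)‖ := posLog_nonneg
  gcongr
  linarith

/-- For `|x| ≤ r` the angle `φ` is real, both exponentials have modulus one and the `log⁺` terms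
vanish. -/
lemma lintegral_logKernel_mul_cos_of_le {x r : ℝ} (hr : 0 < r) (hr2 : r ≤ 2) (hxr : |x| ≤ r) :
    ∫⁻ θ in Ioo 0 π, ENNReal.ofReal (logKernel x (r * cos θ)) =
      ENNReal.ofReal (π * (log 4 - log (r / 2))) := by
  have h1 : -1 ≤ x / r := by rw [le_div_iff₀ hr]; linarith [(abs_le.1 hxr).1]
  have h2 : x / r ≤ 1 := by rw [div_le_iff₀ hr]; linarith [(abs_le.1 hxr).2]
  have hφ : Complex.cos (arccos (x / r) : ℝ) = x / r := by
    rw [← Complex.ofReal_cos, cos_arccos h1 h2]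
    push_cast; rfl
  rw [lintegral_logKernel_mul_cos (hxr.trans hr2) hr hr2 hφ, ← Complex.ofReal_neg,
    Complex.norm_exp_ofReal_mul_I, Complex.norm_exp_ofReal_mul_I]
  simp

/-! ### The effective potential -/

lemma integrableOn_logKernel (h x : ℝ) : IntegrableOn (logKernel x) (Icc (-h) h) := by
  rcases le_or_gt (-h) h with hh | hh
  · refine (integrableOn_const (by simp)).sub ?_
    simp only [log_abs]
    rw [← intervalIntegrable_iff_integrableOn_Icc_of_le hh]
    simpa using (intervalIntegral.intervalIntegrable_log' (a := x - -h) (b := x - h)).comp_sub_left x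
  · rw [Icc_eq_empty (by linarith)]
    exact integrableOn_empty

/-- The external potential is thus a constant minus the logarithmic potential of the uniform density
`1/4`. -/
lemma integral_logKernel {h : ℝ} (hh : 0 ≤ h) (x : ℝ) :
    ∫ y in Icc (-h) h, logKernel x y = 2 * h * log 4 + 2 * h - 4 * potential (2 * h) x := by
  have h1 : IntegrableOn (fun y ↦ log |x - y|) (Icc (-h) h) := by
    have := (integrableOn_const (by simp) : IntegrableOn (fun _ ↦ log 4) (Icc (-h) h)).sub
      (integrableOn_logKernel h x)
    refine this.congr (ae_of_all _ fun y ↦ ?_)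
    simp [logKernel]
  have hc : IntegrableOn (fun _ : ℝ ↦ log 4) (Icc (-h) h) := integrableOn_const (by simp)
  unfold logKernel
  rw [integral_sub hc h1, setIntegral_const, Real.volume_real_Icc_of_le (by linarith)]
  simp only [log_abs]
  rw [integral_Icc_eq_integral_Ioc, ← intervalIntegral.integral_of_le (by linarith),
    intervalIntegral.integral_comp_sub_left, integral_log, potential]
  rw [show 2 * h / 2 = h by ring, show x - h = -(h - x) by ring, log_neg_eq_log,
    show x - -h = h + x by ring, smul_eq_mul]
  ring

lemma integrableOn_arcsinDensity_mul_logKernel (h a x : ℝ) :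
    IntegrableOn (fun y ↦ arcsinDensity h a y * logKernel x y) (Icc (-h) h) := by
  refine Integrable.bdd_mul (c := 1 / 4) (integrableOn_logKernel h x)
    (measurable_arcsinDensity h a).aestronglyMeasurable (ae_of_all _ fun y ↦ ?_)
  rw [Real.norm_of_nonneg (arcsinDensity_nonneg h a y)]
  exact arcsinDensity_le h a y

lemma ofReal_integral_arcsinDensity_mul_logKernel {h a x : ℝ} (hh : h ≤ 2) (hx : |x| ≤ h) :
    ENNReal.ofReal (∫ y in Icc (-h) h, arcsinDensity h a y * logKernel x y) =
      ∫⁻ y in Icc (-h) h, ENNReal.ofReal (arcsinDensity h a y) * ENNReal.ofReal (logKernel x y) := by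
  rw [ofReal_integral_eq_lintegral_ofReal (integrableOn_arcsinDensity_mul_logKernel h a x)]
  · simp only [ENNReal.ofReal_mul (arcsinDensity_nonneg h a _)]
  · refine (ae_restrict_iff' measurableSet_Icc).2 (ae_of_all _ fun y hy ↦ ?_)
    exact mul_nonneg (arcsinDensity_nonneg h a y)
      (logKernel_nonneg (hx.trans hh) ((abs_le.2 hy).trans hh))

lemma lintegral_arcsinDensity_self {h a x : ℝ} (ha : 0 ≤ a) (hah : a ≤ h) :
    ∫⁻ y in Icc (-h) h, ENNReal.ofReal (arcsinDensity h h y) * ENNReal.ofReal (logKernel x y) =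
      (∫⁻ y in Icc (-h) h,
        ENNReal.ofReal (arcsinDensity h a y) * ENNReal.ofReal (logKernel x y)) +
      ∫⁻ r in Ioc a h, ENNReal.ofReal (mixtureWeight h r) *
        ∫⁻ θ in Ioo 0 π, ENNReal.ofReal (logKernel x (r * cos θ)) := by
  have hm : Measurable fun y ↦ ENNReal.ofReal (logKernel x y) :=
    (measurable_logKernel.comp (measurable_const.prodMk measurable_id)).ennreal_ofReal
  rw [lintegral_arcsinDensity_mul (ha.trans hah) le_rfl hm, lintegral_arcsinDensity_mul ha hah hm,
    Measure.restrict_congr_set (Ioo_ae_eq_Ioc (a := (0 : ℝ)) (b := h)),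
    Measure.restrict_congr_set (Ioo_ae_eq_Ioc (a := (0 : ℝ)) (b := a)),
    ← lintegral_union measurableSet_Ioc (Set.disjoint_left.2 fun r hr hr' ↦ hr'.1.not_ge hr.2),
    Ioc_union_Ioc_eq_Ioc ha hah]

/-- Up to a constant, the potential of the uniform density `1/4` is bounded by the potential of
`arcsinDensity h a`, with equality on `[-a, a]`. -/
lemma exists_integral_logKernel_le {h a : ℝ} (ha : 0 ≤ a) (hah : a ≤ h) (hh : h ≤ 2) :
    ∃ C : ℝ, ∀ x, |x| ≤ h →
      (1 / 4 * ∫ y in Icc (-h) h, logKernel x y) ≤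
        (∫ y in Icc (-h) h, arcsinDensity h a y * logKernel x y) + C ∧
      (|x| ≤ a → (1 / 4 * ∫ y in Icc (-h) h, logKernel x y) =
        (∫ y in Icc (-h) h, arcsinDensity h a y * logKernel x y) + C) := by
  set B : ℝ≥0∞ := ∫⁻ r in Ioc a h, ENNReal.ofReal (mixtureWeight h r) *
    ENNReal.ofReal (π * (log 4 - log (r / 2))) with hB
  have hself : ∀ x, 1 / 4 * ∫ y in Icc (-h) h, logKernel x y =
      ∫ y in Icc (-h) h, arcsinDensity h h y * logKernel x y := fun x ↦ by
    rw [← integral_const_mul, integral_Icc_eq_integral_Ioo, integral_Icc_eq_integral_Ioo]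
    refine setIntegral_congr_fun measurableSet_Ioo fun y hy ↦ ?_
    simp only [arcsinDensity_self (abs_lt.2 hy)]
  have hle : ∀ x, |x| ≤ h →
      ENNReal.ofReal (1 / 4 * ∫ y in Icc (-h) h, logKernel x y) ≤
        ENNReal.ofReal (∫ y in Icc (-h) h, arcsinDensity h a y * logKernel x y) + B := fun x hx ↦ by
    rw [hself, ofReal_integral_arcsinDensity_mul_logKernel hh hx,
      ofReal_integral_arcsinDensity_mul_logKernel hh hx, lintegral_arcsinDensity_self ha hah]
    gcongr
    refine setLIntegral_mono' measurableSet_Ioc fun r hr ↦ ?_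
    gcongr
    exact lintegral_logKernel_mul_cos_le (hx.trans hh) (ha.trans_lt hr.1) (hr.2.trans hh)
  have heq : ∀ x, |x| ≤ a →
      ENNReal.ofReal (1 / 4 * ∫ y in Icc (-h) h, logKernel x y) =
        ENNReal.ofReal (∫ y in Icc (-h) h, arcsinDensity h a y * logKernel x y) + B := fun x hx ↦ by
    rw [hself, ofReal_integral_arcsinDensity_mul_logKernel hh (hx.trans hah),
      ofReal_integral_arcsinDensity_mul_logKernel hh (hx.trans hah),
      lintegral_arcsinDensity_self ha hah]
    congr 1
    refine setLIntegral_congr_fun measurableSet_Ioc fun r hr ↦ ?_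
    simp only [lintegral_logKernel_mul_cos_of_le (ha.trans_lt hr.1) (hr.2.trans hh)
      (hx.trans hr.1.le)]
  -- Finiteness comes for free from the equality at `x = 0`, whose left side is finite.
  have hBtop : B ≠ ⊤ := fun h ↦ by
    have := heq 0 (by simpa using ha)
    rw [h, add_top] at this
    exact ENNReal.ofReal_ne_top this
  have hnn : ∀ x b, |x| ≤ h → 0 ≤ ∫ y in Icc (-h) h, arcsinDensity h b y * logKernel x y :=
    fun x b hx ↦ setIntegral_nonneg measurableSet_Icc fun y hy ↦
      mul_nonneg (arcsinDensity_nonneg h b y)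
        (logKernel_nonneg (hx.trans hh) ((abs_le.2 hy).trans hh))
  refine ⟨B.toReal, fun x hx ↦ ⟨?_, fun hxa ↦ ?_⟩⟩
  · have := hle x hx
    rw [← ENNReal.ofReal_toReal hBtop, ← ENNReal.ofReal_add (hnn x a hx) ENNReal.toReal_nonneg]
      at this
    exact (ENNReal.ofReal_le_ofReal_iff (add_nonneg (hnn x a hx) ENNReal.toReal_nonneg)).1 this
  · have := heq x hxa
    rw [← ENNReal.ofReal_toReal hBtop, ← ENNReal.ofReal_add (hnn x a hx) ENNReal.toReal_nonneg]
      at this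
    refine (ENNReal.ofReal_eq_ofReal_iff ?_ (add_nonneg (hnn x a hx) ENNReal.toReal_nonneg)).1 this
    rw [hself]
    exact hnn x h hx

lemma integral_arcsinDensity {h a : ℝ} (ha : 0 ≤ a) (hah : a ≤ h) :
    ∫ y in Icc (-h) h, arcsinDensity h a y = 1 / 2 * (h - √(h ^ 2 - a ^ 2)) := by
  rw [integral_eq_lintegral_of_nonneg_ae (ae_of_all _ (arcsinDensity_nonneg h a))
    (measurable_arcsinDensity h a).aestronglyMeasurable, lintegral_arcsinDensity ha hah,
    ENNReal.toReal_ofReal]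
  have : √(h ^ 2 - a ^ 2) ≤ h := by
    refine (sqrt_le_sqrt (by nlinarith : h ^ 2 - a ^ 2 ≤ h ^ 2)).trans ?_
    rw [sqrt_sq (ha.trans hah)]
  linarith

lemma integrableOn_arcsinDensity (h a : ℝ) : IntegrableOn (arcsinDensity h a) (Icc (-h) h) := by
  refine Measure.integrableOn_of_bounded (M := 1 / 4) (by simp)
    (measurable_arcsinDensity h a).aestronglyMeasurable (ae_of_all _ fun y ↦ ?_)
  rw [Real.norm_of_nonneg (arcsinDensity_nonneg h a y)]
  exact arcsinDensity_le h a y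

/-! ### Positivity of the logarithmic energy -/

/-- Lebesgue measure on `[-h, h]`. -/
abbrev intervalMeasure (h : ℝ) : Measure ℝ := volume.restrict (Icc (-h) h)

lemma ae_intervalMeasure_abs_le (h : ℝ) : ∀ᵐ x ∂intervalMeasure h, |x| ≤ h :=
  (ae_restrict_iff' measurableSet_Icc).2 (ae_of_all _ fun _ hx ↦ abs_le.2 hx)

/-- An integrable function all of whose moments on `[-h, h]` vanish is zero. -/
lemma ae_eq_zero_of_moments_eq_zero {h : ℝ} {φ : ℝ → ℝ} (hφ : Integrable φ (intervalMeasure h))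
    (hm : ∀ n : ℕ, ∫ x, φ x * x ^ n ∂intervalMeasure h = 0) : ∀ᵐ x ∂intervalMeasure h, φ x = 0 := by
  have hcont : ∀ f : ℝ → ℝ, Continuous f → Integrable (fun x ↦ φ x * f x) (intervalMeasure h) := by
    intro f hf
    obtain ⟨M, hM⟩ := isCompact_Icc.exists_bound_of_continuousOn (s := Icc (-h) h) hf.continuousOn
    exact hφ.mul_bdd (c := M) hf.aestronglyMeasurable
      ((ae_restrict_iff' measurableSet_Icc).2 (ae_of_all _ hM))
  have hpoly : ∀ p : Polynomial ℝ, ∫ x, φ x * p.eval x ∂intervalMeasure h = 0 := by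
    intro p
    simp only [Polynomial.eval_eq_sum_range, Finset.mul_sum]
    rw [integral_finsetSum _ fun i _ ↦ hcont _ (by fun_prop)]
    refine Finset.sum_eq_zero fun i _ ↦ ?_
    have : ∀ x, φ x * (p.coeff i * x ^ i) = p.coeff i * (φ x * x ^ i) := fun x ↦ by ring
    simp only [this]
    rw [integral_const_mul, hm, mul_zero]
  -- It suffices to test against smooth functions, which polynomials approximate uniformly on `[-h,
  -- h]`.
  refine ae_eq_zero_of_integral_contDiff_smul_eq_zero hφ.locallyIntegrable fun g hg _ ↦ ?_
  simp only [smul_eq_mul, mul_comm (g _)]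
  set K := ∫ x, |φ x| ∂intervalMeasure h with hK
  have hK0 : 0 ≤ K := integral_nonneg fun x ↦ abs_nonneg _
  have hle : ∀ ε > 0, |∫ x, φ x * g x ∂intervalMeasure h| ≤ ε * K := by
    intro ε hε
    obtain ⟨p, hp⟩ := exists_polynomial_near_of_continuousOn (-h) h g hg.continuous.continuousOn ε hε
    have heq : ∫ x, φ x * g x ∂intervalMeasure h =
        ∫ x, φ x * (g x - p.eval x) ∂intervalMeasure h := by
      simp only [mul_sub]
      rw [integral_sub (hcont g hg.continuous) (hcont _ p.continuous), hpoly, sub_zero]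
    rw [heq, hK, ← integral_const_mul]
    refine norm_integral_le_of_norm_le (f := fun x ↦ φ x * (g x - p.eval x)) (hφ.abs.const_mul ε) ?_
    refine (ae_restrict_iff' measurableSet_Icc).2 (ae_of_all _ fun x hx ↦ ?_)
    rw [norm_mul, mul_comm, Real.norm_eq_abs, Real.norm_eq_abs, abs_sub_comm]
    gcongr
    exact (hp x hx).le
  refine abs_nonpos_iff.1 (le_of_forall_pos_le_add fun ε hε ↦ ?_)
  calc |∫ x, φ x * g x ∂intervalMeasure h| ≤ ε / (K + 1) * K := hle _ (by positivity)
    _ ≤ 0 + ε := by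
      rw [div_mul_eq_mul_div, zero_add, div_le_iff₀ (by positivity)]
      nlinarith

/-- The energy of `g` with respect to the Gaussian kernel. -/
def gaussianEnergy (h : ℝ) (g : ℝ → ℝ) (t : ℝ) : ℝ :=
  ∫ p, g p.1 * g p.2 * exp (-(t * (p.1 - p.2) ^ 2)) ∂(intervalMeasure h).prod (intervalMeasure h)

lemma integrable_mul_pow_mul_exp {h : ℝ} {g : ℝ → ℝ} (hg : Integrable g (intervalMeasure h))
    {t : ℝ} (ht : 0 ≤ t) (n : ℕ) :
    Integrable (fun x ↦ g x * (exp (-(t * x ^ 2)) * x ^ n)) (intervalMeasure h) ∧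
      ∫ x, ‖g x * (exp (-(t * x ^ 2)) * x ^ n)‖ ∂intervalMeasure h ≤
        |h| ^ n * ∫ x, ‖g x‖ ∂intervalMeasure h := by
  have hb : ∀ᵐ x ∂intervalMeasure h, ‖exp (-(t * x ^ 2)) * x ^ n‖ ≤ |h| ^ n := by
    filter_upwards [ae_intervalMeasure_abs_le h] with x hx
    rw [norm_mul, norm_pow, Real.norm_of_nonneg (exp_pos _).le, Real.norm_eq_abs]
    calc exp (-(t * x ^ 2)) * |x| ^ n ≤ 1 * |h| ^ n := by
          exact mul_le_mul (exp_le_one_iff.2 (neg_nonpos.2 (by positivity)))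
            (pow_le_pow_left₀ (abs_nonneg x) (hx.trans (le_abs_self h)) n) (by positivity)
            zero_le_one
      _ = |h| ^ n := one_mul _
  have hi := hg.mul_bdd (c := |h| ^ n)
    (by fun_prop : AEStronglyMeasurable (fun x ↦ exp (-(t * x ^ 2)) * x ^ n) (intervalMeasure h)) hb
  refine ⟨hi, ?_⟩
  rw [← integral_const_mul]
  refine integral_mono_ae hi.norm (hg.norm.const_mul _) ?_
  filter_upwards [hb] with x hx
  rw [norm_mul, mul_comm]
  gcongr

/-- Expanding `exp(2txy)` in `exp(-t(x-y)²) = exp(-tx²) exp(-ty²) exp(2txy)` turns the energy into a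
sum of squares of weighted moments. -/
lemma hasSum_gaussianEnergy {h : ℝ} {g : ℝ → ℝ} (hg : Integrable g (intervalMeasure h))
    {t : ℝ} (ht : 0 ≤ t) :
    HasSum (fun n : ℕ ↦ (2 * t) ^ n / n.factorial *
      (∫ x, g x * (exp (-(t * x ^ 2)) * x ^ n) ∂intervalMeasure h) ^ 2) (gaussianEnergy h g t) := by
  set u : ℕ → ℝ → ℝ := fun n x ↦ g x * (exp (-(t * x ^ 2)) * x ^ n) with hu
  set K := ∫ x, ‖g x‖ ∂intervalMeasure h with hK
  have hui := fun n ↦ (integrable_mul_pow_mul_exp hg ht n).1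
  have hun := fun n ↦ (integrable_mul_pow_mul_exp hg ht n).2
  set F : ℕ → ℝ × ℝ → ℝ := fun n p ↦ (2 * t) ^ n / n.factorial * (u n p.1 * u n p.2) with hF
  have hFi : ∀ n, Integrable (F n) ((intervalMeasure h).prod (intervalMeasure h)) := fun n ↦
    ((hui n).mul_prod (hui n)).const_mul _
  have hFn : ∀ n, ∫ p, ‖F n p‖ ∂(intervalMeasure h).prod (intervalMeasure h) =
      (2 * t) ^ n / n.factorial * (∫ x, ‖u n x‖ ∂intervalMeasure h) ^ 2 := fun n ↦ by
    simp only [hF, norm_mul]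
    rw [integral_const_mul, Real.norm_of_nonneg (by positivity),
      integral_prod_mul (fun x ↦ ‖u n x‖) (fun x ↦ ‖u n x‖), sq]
  have hs : Summable fun n ↦ ∫ p, ‖F n p‖ ∂(intervalMeasure h).prod (intervalMeasure h) := by
    refine Summable.of_nonneg_of_le (fun n ↦ integral_nonneg fun p ↦ norm_nonneg _) (fun n ↦ ?_)
      ((Real.summable_pow_div_factorial (2 * t * h ^ 2)).mul_right (K ^ 2))
    rw [hFn]
    calc (2 * t) ^ n / n.factorial * (∫ x, ‖u n x‖ ∂intervalMeasure h) ^ 2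
        ≤ (2 * t) ^ n / n.factorial * (|h| ^ n * K) ^ 2 := by
          gcongr
          exact hun n
      _ = (2 * t * h ^ 2) ^ n / n.factorial * K ^ 2 := by
          rw [← sq_abs h]; ring
  have hsum := hasSum_integral_of_summable_integral_norm hFi hs
  have hterm : ∀ p : ℝ × ℝ, ∑' n, F n p = g p.1 * g p.2 * exp (-(t * (p.1 - p.2) ^ 2)) := by
    intro p
    have h1 := NormedSpace.expSeries_div_hasSum_exp (2 * t * (p.1 * p.2))
    rw [← Real.exp_eq_exp_ℝ] at h1
    have h2 := h1.mul_left (g p.1 * g p.2 * exp (-(t * p.1 ^ 2)) * exp (-(t * p.2 ^ 2)))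
    have h3 : g p.1 * g p.2 * exp (-(t * (p.1 - p.2) ^ 2)) =
        g p.1 * g p.2 * exp (-(t * p.1 ^ 2)) * exp (-(t * p.2 ^ 2)) *
          exp (2 * t * (p.1 * p.2)) := by
      rw [mul_assoc (_ * _), mul_assoc (_ * _), ← exp_add, ← exp_add]
      congr 2
      ring
    rw [h3, ← h2.tsum_eq]
    congr 1
    ext n
    simp only [hF, hu]
    ring
  have hterms : ∀ n, ∫ p, F n p ∂(intervalMeasure h).prod (intervalMeasure h) =
      (2 * t) ^ n / n.factorial * (∫ x, u n x ∂intervalMeasure h) ^ 2 := fun n ↦ by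
    simp only [hF]
    rw [integral_const_mul, integral_prod_mul (u n) (u n), sq]
  simp only [hterm, hterms] at hsum
  exact hsum

lemma gaussianEnergy_nonneg {h : ℝ} {g : ℝ → ℝ} (hg : Integrable g (intervalMeasure h))
    {t : ℝ} (ht : 0 ≤ t) : 0 ≤ gaussianEnergy h g t :=
  (hasSum_gaussianEnergy hg ht).nonneg fun n ↦ by positivity

lemma ae_eq_zero_of_gaussianEnergy_eq_zero {h : ℝ} {g : ℝ → ℝ}
    (hg : Integrable g (intervalMeasure h)) {t : ℝ} (ht : 0 < t) (h0 : gaussianEnergy h g t = 0) :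
    ∀ᵐ x ∂intervalMeasure h, g x = 0 := by
  have hs := hasSum_gaussianEnergy hg ht.le
  rw [h0, hasSum_zero_iff_of_nonneg fun n ↦ by positivity] at hs
  have hmom : ∀ n : ℕ, ∫ x, (g x * exp (-(t * x ^ 2))) * x ^ n ∂intervalMeasure h = 0 := fun n ↦ by
    have := congr_fun hs n
    simp only [Pi.zero_apply] at this
    simp only [mul_assoc]
    exact pow_eq_zero_iff two_ne_zero |>.1 ((mul_eq_zero.1 this).resolve_left (by positivity))
  have hi : Integrable (fun x ↦ g x * exp (-(t * x ^ 2))) (intervalMeasure h) := by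
    simpa using (integrable_mul_pow_mul_exp hg ht.le 0).1
  filter_upwards [ae_eq_zero_of_moments_eq_zero hi hmom] with x hx
  exact (mul_eq_zero.1 hx).resolve_right (exp_pos _).ne'

/-- A representation of the logarithm in terms of exponentials. -/
lemma integral_exp_sub_exp_div {s b : ℝ} (hs : 0 < s) (hsb : s ≤ b) :
    IntegrableOn (fun t ↦ t⁻¹ * (exp (-(s * t)) - exp (-(b * t)))) (Ioi 0) ∧
      ∫ t in Ioi 0, t⁻¹ * (exp (-(s * t)) - exp (-(b * t))) = log (b / s) := by
  have hint : IntegrableOn (fun t ↦ t⁻¹ * (exp (-(s * t)) - exp (-(b * t)))) (Ioi 0) := by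
    -- The bound `(b - s) exp(-st)` follows from `1 + u ≤ exp u` with `u = -(b - s)t`.
    refine Integrable.mono' ((exp_neg_integrableOn_Ioi 0 hs).const_mul (b - s))
      (by fun_prop) ((ae_restrict_iff' measurableSet_Ioi).2 (ae_of_all _ fun t (ht : 0 < t) ↦ ?_))
    have h1 : exp (-(b * t)) ≤ exp (-(s * t)) := by
      gcongr
    rw [Real.norm_of_nonneg (mul_nonneg (by positivity) (sub_nonneg.2 h1)), inv_mul_le_iff₀ ht]
    have h2 : exp (-(b * t)) = exp (-(s * t)) * exp (-((b - s) * t)) := by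
      rw [← exp_add]; congr 1; ring
    have h3 := add_one_le_exp (-((b - s) * t))
    rw [h2, neg_mul]
    nlinarith [exp_pos (-(s * t))]
  refine ⟨hint, ?_⟩
  have := Frullani.integral_Ioi_eq (f := fun t : ℝ ↦ exp (-t)) (a := s) (b := b) (L := 1) (R := 0)
    (by exact ContinuousOn.locallyIntegrableOn (by fun_prop) measurableSet_Ioi) hs (hs.trans_le hsb)
    ?_ (tendsto_exp_neg_atTop_nhds_zero) hint
  · simpa using this
  · have hc : ContinuousAt (fun t : ℝ ↦ exp (-t)) 0 := by fun_prop
    simpa using hc.tendsto.mono_left (nhdsWithin_le_nhds (s := Ioi 0))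

lemma integrable_logKernel {h : ℝ} (hh : 0 ≤ h) (hh2 : h ≤ 2) :
    Integrable (fun p : ℝ × ℝ ↦ logKernel p.1 p.2)
      ((intervalMeasure h).prod (intervalMeasure h)) := by
  rw [integrable_prod_iff (f := fun p : ℝ × ℝ ↦ logKernel p.1 p.2)
    measurable_logKernel.aestronglyMeasurable]
  refine ⟨ae_of_all _ fun x ↦ integrableOn_logKernel h x, ?_⟩
  have hc : Continuous fun x ↦ 2 * h * log 4 + 2 * h - 4 * potential (2 * h) x := by
    have h1 : Continuous fun x ↦ (2 * h / 2 + x) * log (2 * h / 2 + x) :=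
      Real.continuous_mul_log.comp (continuous_const.add continuous_id)
    have h2 : Continuous fun x ↦ (2 * h / 2 - x) * log (2 * h / 2 - x) :=
      Real.continuous_mul_log.comp (continuous_const.sub continuous_id)
    unfold potential
    fun_prop
  refine (hc.continuousOn.integrableOn_compact (isCompact_Icc (a := -h) (b := h))).congr ?_
  filter_upwards [ae_intervalMeasure_abs_le h] with x hx
  rw [← integral_logKernel hh]
  refine setIntegral_congr_fun measurableSet_Icc fun y hy ↦ ?_
  exact (Real.norm_of_nonneg (logKernel_nonneg (hx.trans hh2) ((abs_le.2 hy).trans hh2))).symm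

lemma integrable_mul_mul_logKernel {h M N : ℝ} (hh : 0 ≤ h) (hh2 : h ≤ 2) {f g : ℝ → ℝ}
    (hf : AEStronglyMeasurable f (intervalMeasure h)) (hfM : ∀ᵐ x ∂intervalMeasure h, ‖f x‖ ≤ M)
    (hg : AEStronglyMeasurable g (intervalMeasure h)) (hgN : ∀ᵐ x ∂intervalMeasure h, ‖g x‖ ≤ N) :
    Integrable (fun p : ℝ × ℝ ↦ f p.1 * g p.2 * logKernel p.1 p.2)
      ((intervalMeasure h).prod (intervalMeasure h)) := by
  refine (integrable_logKernel hh hh2).bdd_mul (c := M * N) (hf.comp_fst.mul hg.comp_snd) ?_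
  filter_upwards [Measure.quasiMeasurePreserving_fst.ae hfM,
    Measure.quasiMeasurePreserving_snd.ae hgN] with p h1 h2
  rw [norm_mul]
  exact mul_le_mul h1 h2 (norm_nonneg _) ((norm_nonneg _).trans h1)

/-- The logarithmic energy of `g`. -/
def logEnergy (h : ℝ) (g : ℝ → ℝ) : ℝ :=
  ∫ p, g p.1 * g p.2 * logKernel p.1 p.2 ∂(intervalMeasure h).prod (intervalMeasure h)

lemma ae_fst_ne_snd (h : ℝ) :
    ∀ᵐ p : ℝ × ℝ ∂(intervalMeasure h).prod (intervalMeasure h), p.1 ≠ p.2 := by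
  rw [Measure.ae_prod_iff_ae_ae
    (by exact (measurableSet_eq_fun measurable_fst measurable_snd).compl)]
  refine ae_of_all _ fun x ↦ ae_restrict_of_ae ?_
  filter_upwards [compl_mem_ae_iff.2 (measure_singleton x)] with y hy h
  exact hy h.symm

/-- The number `16 = 4²` matches the shift `log 4` of the kernel and bounds `(x - y)²`, which keeps
the integrand nonnegative. -/
lemma integral_exp_sub_exp_eq_logKernel {x y : ℝ} (hx : |x| ≤ 2) (hy : |y| ≤ 2) (hxy : x ≠ y) :
    IntegrableOn (fun t ↦ t⁻¹ * (exp (-((x - y) ^ 2 * t)) - exp (-(16 * t)))) (Ioi 0) ∧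
      ∫ t in Ioi 0, t⁻¹ * (exp (-((x - y) ^ 2 * t)) - exp (-(16 * t))) = 2 * logKernel x y := by
  have h0 : x - y ≠ 0 := sub_ne_zero.2 hxy
  have h1 : (x - y) ^ 2 ≤ 16 := by
    rw [abs_le] at hx hy
    nlinarith [hx.1, hx.2, hy.1, hy.2]
  obtain ⟨hi, he⟩ := integral_exp_sub_exp_div (by positivity : 0 < (x - y) ^ 2) h1
  refine ⟨hi, he.trans ?_⟩
  rw [log_div (by norm_num) (by positivity), logKernel, log_abs, log_pow,
    show (16 : ℝ) = 4 ^ 2 by norm_num, log_pow]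
  push_cast
  ring

/-- The logarithmic energy of a function of mean zero as a mixture of Gaussian energies. -/
lemma two_mul_logEnergy {h M : ℝ} (hh : 0 ≤ h) (hh2 : h ≤ 2) {g : ℝ → ℝ}
    (hg : AEStronglyMeasurable g (intervalMeasure h)) (hgM : ∀ᵐ x ∂intervalMeasure h, ‖g x‖ ≤ M)
    (h0 : ∫ x, g x ∂intervalMeasure h = 0) :
    IntegrableOn (fun t ↦ t⁻¹ * gaussianEnergy h g t) (Ioi 0) ∧
      2 * logEnergy h g = ∫ t in Ioi 0, t⁻¹ * gaussianEnergy h g t := by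
  set μ := intervalMeasure h
  have hgi : Integrable g μ := Integrable.of_bound hg M hgM
  have hgg : Integrable (fun p : ℝ × ℝ ↦ g p.1 * g p.2) (μ.prod μ) := hgi.mul_prod hgi
  set F : ℝ × ℝ → ℝ → ℝ := fun p t ↦
    g p.1 * g p.2 * (t⁻¹ * (exp (-((p.1 - p.2) ^ 2 * t)) - exp (-(16 * t)))) with hF
  have hae : ∀ᵐ p ∂μ.prod μ, IntegrableOn (fun t ↦
      t⁻¹ * (exp (-((p.1 - p.2) ^ 2 * t)) - exp (-(16 * t)))) (Ioi 0) ∧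
      ∫ t in Ioi 0, t⁻¹ * (exp (-((p.1 - p.2) ^ 2 * t)) - exp (-(16 * t))) =
        2 * logKernel p.1 p.2 ∧ (p.1 - p.2) ^ 2 ≤ 16 := by
    filter_upwards [ae_fst_ne_snd h,
      Measure.quasiMeasurePreserving_fst.ae (ae_intervalMeasure_abs_le h),
      Measure.quasiMeasurePreserving_snd.ae (ae_intervalMeasure_abs_le h)] with p h1 h2 h3
    obtain ⟨e1, e2⟩ := integral_exp_sub_exp_eq_logKernel (h2.trans hh2) (h3.trans hh2) h1
    refine ⟨e1, e2, ?_⟩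
    rw [abs_le] at h2 h3
    nlinarith [h2.1, h2.2, h3.1, h3.2]
  have hFm : AEStronglyMeasurable (Function.uncurry F) ((μ.prod μ).prod (volume.restrict (Ioi 0))) := by
    refine AEStronglyMeasurable.mul hgg.aestronglyMeasurable.comp_fst ?_
    exact Measurable.aestronglyMeasurable (by fun_prop)
  -- As the exponential difference is nonnegative, the integral of `‖F p t‖` over `t` is `2 ‖g p.1 *
  -- g p.2‖ logKernel p.1 p.2`.
  have hFi : Integrable (Function.uncurry F) ((μ.prod μ).prod (volume.restrict (Ioi 0))) := by
    rw [integrable_prod_iff hFm]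
    constructor
    · filter_upwards [hae] with p hp
      exact hp.1.const_mul (g p.1 * g p.2)
    · refine ((integrable_mul_mul_logKernel hh hh2 hg hgM hg hgM).norm.const_mul 2).congr ?_
      filter_upwards [hae, Measure.quasiMeasurePreserving_fst.ae (ae_intervalMeasure_abs_le h),
        Measure.quasiMeasurePreserving_snd.ae (ae_intervalMeasure_abs_le h)] with p hp h2 h3
      simp only [Function.uncurry, hF, norm_mul (g p.1 * g p.2)]
      rw [integral_const_mul, Real.norm_of_nonneg
        (logKernel_nonneg (h2.trans hh2) (h3.trans hh2)), mul_left_comm, ← hp.2.1]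
      congr 1
      refine setIntegral_congr_fun measurableSet_Ioi fun t (ht : 0 < t) ↦ ?_
      refine (Real.norm_of_nonneg (mul_nonneg (by positivity) (sub_nonneg.2 ?_))).symm
      gcongr
      exact hp.2.2
  have hright : ∀ t ∈ Ioi (0 : ℝ), ∫ p, F p t ∂μ.prod μ = t⁻¹ * gaussianEnergy h g t := by
    intro t ht
    have i1 : Integrable (fun p : ℝ × ℝ ↦ g p.1 * g p.2 * exp (-(t * (p.1 - p.2) ^ 2)))
        (μ.prod μ) := by
      refine hgg.mul_bdd (c := 1) (Measurable.aestronglyMeasurable (by fun_prop))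
        (ae_of_all _ fun p ↦ ?_)
      rw [Real.norm_of_nonneg (exp_pos _).le, exp_le_one_iff]
      have : 0 < t := ht
      exact neg_nonpos.2 (by positivity)
    have heq : ∀ p, F p t = t⁻¹ * (g p.1 * g p.2 * exp (-(t * (p.1 - p.2) ^ 2)) -
        exp (-(16 * t)) * (g p.1 * g p.2)) := fun p ↦ by
      simp only [hF, mul_comm t]
      ring
    simp only [heq]
    -- Mean zero removes the subtracted term `exp(-16t)`, leaving the Gaussian energy.
    rw [integral_const_mul, integral_sub i1 (hgg.const_mul _), integral_const_mul,
      integral_prod_mul g g, h0]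
    simp only [mul_zero, sub_zero]
    rfl
  constructor
  · refine Integrable.congr hFi.integral_prod_right ?_
    exact (ae_restrict_iff' measurableSet_Ioi).2 (ae_of_all _ hright)
  · rw [← setIntegral_congr_fun measurableSet_Ioi hright, ← integral_integral_swap hFi, logEnergy,
      ← integral_const_mul]
    refine integral_congr_ae ?_
    filter_upwards [hae] with p hp
    simp only [hF]
    rw [integral_const_mul, hp.2.1]
    ring

lemma logEnergy_nonneg {h M : ℝ} (hh : 0 ≤ h) (hh2 : h ≤ 2) {g : ℝ → ℝ}
    (hg : AEStronglyMeasurable g (intervalMeasure h)) (hgM : ∀ᵐ x ∂intervalMeasure h, ‖g x‖ ≤ M)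
    (h0 : ∫ x, g x ∂intervalMeasure h = 0) : 0 ≤ logEnergy h g := by
  have h1 := (two_mul_logEnergy hh hh2 hg hgM h0).2
  have h2 : 0 ≤ ∫ t in Ioi 0, t⁻¹ * gaussianEnergy h g t :=
    setIntegral_nonneg measurableSet_Ioi fun t (ht : 0 < t) ↦
      mul_nonneg (by positivity) (gaussianEnergy_nonneg (Integrable.of_bound hg M hgM) ht.le)
  linarith

lemma ae_eq_zero_of_logEnergy_eq_zero {h M : ℝ} (hh : 0 ≤ h) (hh2 : h ≤ 2) {g : ℝ → ℝ}
    (hg : AEStronglyMeasurable g (intervalMeasure h)) (hgM : ∀ᵐ x ∂intervalMeasure h, ‖g x‖ ≤ M)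
    (h0 : ∫ x, g x ∂intervalMeasure h = 0) (he : logEnergy h g = 0) :
    ∀ᵐ x ∂intervalMeasure h, g x = 0 := by
  obtain ⟨h1, h2⟩ := two_mul_logEnergy hh hh2 hg hgM h0
  have hgi := Integrable.of_bound hg M hgM
  rw [he, mul_zero, eq_comm, integral_eq_zero_iff_of_nonneg_ae
    ((ae_restrict_iff' measurableSet_Ioi).2 (ae_of_all _ fun t (ht : 0 < t) ↦
      mul_nonneg (by positivity) (gaussianEnergy_nonneg hgi ht.le))) h1,
    EventuallyEq, ae_restrict_iff' measurableSet_Ioi] at h2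
  have hpos : (volume (Ioi (0 : ℝ))) ≠ 0 := by simp
  -- A single `t > 0` with vanishing Gaussian energy is enough.
  obtain ⟨t, ht, ht'⟩ := (frequently_ae_mem_iff.2 hpos).and_eventually h2 |>.exists
  have ht0 : 0 < t := ht
  refine ae_eq_zero_of_gaussianEnergy_eq_zero hgi ht0 ?_
  exact (mul_eq_zero.1 (ht' ht)).resolve_left (by positivity)

/-! ### The minimizer -/

lemma continuous_potential (c : ℝ) : Continuous (potential c) := by
  have h1 : Continuous fun x ↦ (c / 2 + x) * log (c / 2 + x) :=
    Real.continuous_mul_log.comp (continuous_const.add continuous_id)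
  have h2 : Continuous fun x ↦ (c / 2 - x) * log (c / 2 - x) :=
    Real.continuous_mul_log.comp (continuous_const.sub continuous_id)
  unfold potential
  fun_prop

lemma integrable_mul_potential {h c : ℝ} {f : ℝ → ℝ} (hf : Integrable f (intervalMeasure h)) :
    Integrable (fun x ↦ f x * potential c x) (intervalMeasure h) := by
  obtain ⟨M, hM⟩ := isCompact_Icc.exists_bound_of_continuousOn (s := Icc (-h) h)
    (continuous_potential c).continuousOn
  exact hf.mul_bdd (c := M) (continuous_potential c).aestronglyMeasurable
    ((ae_restrict_iff' measurableSet_Icc).2 (ae_of_all _ hM))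

/-- Because the mass is one, shifting the kernel by `log 4` changes the energy only by a constant.
-/
lemma energy_eq {c M : ℝ} (hc₀ : 0 ≤ c) (hc₄ : c ≤ 4) {ρ : ℝ → ℝ}
    (hρ : AEStronglyMeasurable ρ (intervalMeasure (c / 2)))
    (hρM : ∀ᵐ x ∂intervalMeasure (c / 2), ‖ρ x‖ ≤ M)
    (h1 : ∫ x, ρ x ∂intervalMeasure (c / 2) = 1) :
    energy c ρ = 1 / 2 * logEnergy (c / 2) ρ - 1 / 2 * log 4 +
      ∫ x, ρ x * potential c x ∂intervalMeasure (c / 2) := by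
  have hi : Integrable ρ (intervalMeasure (c / 2)) := Integrable.of_bound hρ M hρM
  have hK := integrable_mul_mul_logKernel (by linarith) (by linarith) hρ hρM hρ hρM
  have hρρ := (hi.mul_prod hi).const_mul (log 4)
  have key : ∫ x in domain c, ∫ y in domain c, ρ x * ρ y * log (|x - y|⁻¹) =
      logEnergy (c / 2) ρ - log 4 := by
    have heq : ∀ x y, ρ x * ρ y * log (|x - y|⁻¹) =
        ρ x * ρ y * logKernel x y - log 4 * (ρ x * ρ y) := fun x y ↦ by
      rw [log_inv, logKernel]; ring
    simp only [heq]
    have := integral_prod _ (hK.sub hρρ)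
    simp only [Pi.sub_apply] at this
    rw [integral_sub hK hρρ, integral_const_mul, integral_prod_mul ρ ρ, h1] at this
    simp only [mul_one] at this
    exact this.symm
  rw [energy, key]
  simp only [domain]
  ring

lemma logEnergy_add {h M N : ℝ} (hh : 0 ≤ h) (hh2 : h ≤ 2) {ρ g : ℝ → ℝ}
    (hρ : AEStronglyMeasurable ρ (intervalMeasure h)) (hρM : ∀ᵐ x ∂intervalMeasure h, ‖ρ x‖ ≤ M)
    (hg : AEStronglyMeasurable g (intervalMeasure h)) (hgN : ∀ᵐ x ∂intervalMeasure h, ‖g x‖ ≤ N) :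
    Integrable (fun x ↦ g x * ∫ y, ρ y * logKernel x y ∂intervalMeasure h) (intervalMeasure h) ∧
    logEnergy h (fun x ↦ ρ x + g x) = logEnergy h ρ +
      2 * (∫ x, g x * ∫ y, ρ y * logKernel x y ∂intervalMeasure h ∂intervalMeasure h) +
      logEnergy h g := by
  have i1 := integrable_mul_mul_logKernel hh hh2 hρ hρM hρ hρM
  have i2 := integrable_mul_mul_logKernel hh hh2 hg hgN hρ hρM
  have i3 := integrable_mul_mul_logKernel hh hh2 hρ hρM hg hgN
  have i4 := integrable_mul_mul_logKernel hh hh2 hg hgN hg hgN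
  have hsymm : ∀ x y, logKernel x y = logKernel y x := fun x y ↦ by
    rw [logKernel, logKernel, abs_sub_comm]
  have e2 : ∫ p, g p.1 * ρ p.2 * logKernel p.1 p.2 ∂(intervalMeasure h).prod (intervalMeasure h) =
      ∫ x, g x * ∫ y, ρ y * logKernel x y ∂intervalMeasure h ∂intervalMeasure h := by
    rw [integral_prod _ i2]
    simp only [mul_assoc, integral_const_mul]
  have e3 : ∫ p, ρ p.1 * g p.2 * logKernel p.1 p.2 ∂(intervalMeasure h).prod (intervalMeasure h) =
      ∫ x, g x * ∫ y, ρ y * logKernel x y ∂intervalMeasure h ∂intervalMeasure h := by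
    rw [← e2, ← integral_prod_swap]
    refine integral_congr_ae (ae_of_all _ fun p ↦ ?_)
    simp only [Prod.fst_swap, Prod.snd_swap, hsymm p.2 p.1, mul_comm (ρ p.2)]
  refine ⟨?_, ?_⟩
  · refine i2.integral_prod_left.congr (ae_of_all _ fun x ↦ ?_)
    simp only [mul_assoc, integral_const_mul]
  · have heq : ∀ p : ℝ × ℝ, (ρ p.1 + g p.1) * (ρ p.2 + g p.2) * logKernel p.1 p.2 =
        ρ p.1 * ρ p.2 * logKernel p.1 p.2 + g p.1 * ρ p.2 * logKernel p.1 p.2 +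
          (ρ p.1 * g p.2 * logKernel p.1 p.2 + g p.1 * g p.2 * logKernel p.1 p.2) :=
      fun p ↦ by ring
    have i12 : Integrable (fun p : ℝ × ℝ ↦ ρ p.1 * ρ p.2 * logKernel p.1 p.2 +
        g p.1 * ρ p.2 * logKernel p.1 p.2) ((intervalMeasure h).prod (intervalMeasure h)) := i1.add i2
    have i34 : Integrable (fun p : ℝ × ℝ ↦ ρ p.1 * g p.2 * logKernel p.1 p.2 +
        g p.1 * g p.2 * logKernel p.1 p.2) ((intervalMeasure h).prod (intervalMeasure h)) := i3.add i4
    simp only [logEnergy, heq]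
    rw [integral_add i12 i34, integral_add i1 i2, integral_add i3 i4, e2, e3]
    ring

lemma IsAdmissible.norm_le {c : ℝ} {σ : ℝ → ℝ} (hσ : IsAdmissible c σ) :
    ∀ᵐ x ∂intervalMeasure (c / 2), ‖σ x‖ ≤ 1 / 2 := by
  have h1 : ∀ᵐ x ∂intervalMeasure (c / 2), 0 ≤ σ x := hσ.nonneg
  have h2 : ∀ᵐ x ∂intervalMeasure (c / 2), σ x ≤ 1 / 2 := hσ.le_half
  filter_upwards [h1, h2] with x h1 h2
  rwa [Real.norm_of_nonneg h1]

/-- The effective potential of the density `1/2 - arcsinDensity` is constant on the support of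
`arcsinDensity`, and not larger elsewhere. -/
lemma exists_effectivePotential_le {c : ℝ} (hc₂ : 2 ≤ c) (hc₄ : c ≤ 4) :
    ∃ l : ℝ, ∀ x, |x| ≤ c / 2 →
      (∫ y, (1 / 2 - arcsinDensity (c / 2) (endpoint c) y) * logKernel x y
        ∂intervalMeasure (c / 2)) + potential c x ≤ l ∧
      (|x| ≤ endpoint c →
        (∫ y, (1 / 2 - arcsinDensity (c / 2) (endpoint c) y) * logKernel x y
          ∂intervalMeasure (c / 2)) + potential c x = l) := by
  obtain ⟨C, hC⟩ := exists_integral_logKernel_le (endpoint_nonneg c) (endpoint_le hc₂)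
    (by linarith : c / 2 ≤ 2)
  -- If `U` is the integral of `logKernel x` over the interval, then `V₀ = (c log 4 + c - U)/4`, so
  -- `U/2 + V₀ = U/4 + (c log 4 + c)/4`.
  refine ⟨C + c / 4 * log 4 + c / 4, fun x hx ↦ ?_⟩
  have hV := integral_logKernel (by linarith : 0 ≤ c / 2) x
  rw [show 2 * (c / 2) = c by ring] at hV
  have hsplit : ∫ y, (1 / 2 - arcsinDensity (c / 2) (endpoint c) y) * logKernel x y
      ∂intervalMeasure (c / 2) = 1 / 2 * (∫ y in Icc (-(c / 2)) (c / 2), logKernel x y) -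
        ∫ y in Icc (-(c / 2)) (c / 2), arcsinDensity (c / 2) (endpoint c) y * logKernel x y := by
    simp only [sub_mul]
    rw [integral_sub ((integrableOn_logKernel _ x).const_mul _)
      (integrableOn_arcsinDensity_mul_logKernel _ _ x), integral_const_mul]
  obtain ⟨h1, h2⟩ := hC x hx
  rw [hsplit]
  exact ⟨by linarith, fun hxa ↦ by linarith [h2 hxa]⟩

lemma isAdmissible_half_sub_arcsinDensity {c : ℝ} (hc₂ : 2 ≤ c) (hc₄ : c ≤ 4) :
    IsAdmissible c fun x ↦ 1 / 2 - arcsinDensity (c / 2) (endpoint c) x where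
  aemeasurable := (measurable_const.sub (measurable_arcsinDensity _ _)).aemeasurable
  nonneg := ae_of_all _ fun x ↦ by linarith [arcsinDensity_le (c / 2) (endpoint c) x]
  le_half := ae_of_all _ fun x ↦ by linarith [arcsinDensity_nonneg (c / 2) (endpoint c) x]
  mass := by
    have hi := integrableOn_arcsinDensity (c / 2) (endpoint c)
    have hconst : IntegrableOn (fun _ : ℝ ↦ (1 / 2 : ℝ)) (Icc (-(c / 2)) (c / 2)) :=
      integrableOn_const (by simp)
    rw [domain, integral_sub hconst hi, setIntegral_const,
      Real.volume_real_Icc_of_le (by linarith),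
      integral_arcsinDensity (endpoint_nonneg c) (endpoint_le hc₂), sqrt_sq_sub_endpoint_sq hc₂ hc₄,
      smul_eq_mul]
    ring

/-- The energy of an admissible density exceeds that of `1/2 - arcsinDensity` by at least half the
logarithmic energy of the difference. -/
lemma energy_add_logEnergy_le {c : ℝ} (hc₂ : 2 ≤ c) (hc₄ : c ≤ 4) {σ : ℝ → ℝ}
    (hσ : IsAdmissible c σ) :
    energy c (fun x ↦ 1 / 2 - arcsinDensity (c / 2) (endpoint c) x) +
      1 / 2 * logEnergy (c / 2)
        (fun x ↦ σ x - (1 / 2 - arcsinDensity (c / 2) (endpoint c) x)) ≤ energy c σ := by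
  have hadm := isAdmissible_half_sub_arcsinDensity hc₂ hc₄
  obtain ⟨l, hl⟩ := exists_effectivePotential_le hc₂ hc₄
  set ρ : ℝ → ℝ := fun x ↦ 1 / 2 - arcsinDensity (c / 2) (endpoint c) x with hρdef
  set g : ℝ → ℝ := fun x ↦ σ x - ρ x with hgdef
  have hρm : AEStronglyMeasurable ρ (intervalMeasure (c / 2)) := hadm.aemeasurable.aestronglyMeasurable
  have hσm : AEStronglyMeasurable σ (intervalMeasure (c / 2)) := hσ.aemeasurable.aestronglyMeasurable
  have hσM := hσ.norm_le
  have hρM := hadm.norm_le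
  have hgm : AEStronglyMeasurable g (intervalMeasure (c / 2)) := hσm.sub hρm
  have hgM : ∀ᵐ x ∂intervalMeasure (c / 2), ‖g x‖ ≤ 1 / 2 + 1 / 2 := by
    filter_upwards [hσM, hρM] with x h1 h2
    exact (norm_sub_le _ _).trans (add_le_add h1 h2)
  have hσi : Integrable σ (intervalMeasure (c / 2)) := Integrable.of_bound hσm _ hσM
  have hρi : Integrable ρ (intervalMeasure (c / 2)) := Integrable.of_bound hρm _ hρM
  have hgi : Integrable g (intervalMeasure (c / 2)) := hσi.sub hρi
  have hσ1 : ∫ x, σ x ∂intervalMeasure (c / 2) = 1 := hσ.mass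
  have hρ1 : ∫ x, ρ x ∂intervalMeasure (c / 2) = 1 := hadm.mass
  have hg0 : ∫ x, g x ∂intervalMeasure (c / 2) = 0 := by rw [integral_sub hσi hρi, hσ1, hρ1, sub_self]
  obtain ⟨hPi, hadd⟩ := logEnergy_add (by linarith : 0 ≤ c / 2) (by linarith) hρm hρM hgm hgM
  have hσeq : (fun x ↦ ρ x + g x) = σ := by ext x; simp [hgdef]
  rw [hσeq] at hadd
  have hVg := integrable_mul_potential (c := c) hgi
  have hVσ : ∫ x, σ x * potential c x ∂intervalMeasure (c / 2) =
      (∫ x, ρ x * potential c x ∂intervalMeasure (c / 2)) + ∫ x, g x * potential c x ∂intervalMeasure (c / 2) := by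
    rw [← integral_add (integrable_mul_potential hρi) hVg]
    simp [hgdef, sub_mul]
  -- This is the first variation. Since `g` has mean zero, `l` may be subtracted from the effective
  -- potential.
  have hmain : 0 ≤ (∫ x, g x * ∫ y, ρ y * logKernel x y ∂intervalMeasure (c / 2) ∂intervalMeasure (c / 2)) +
      ∫ x, g x * potential c x ∂intervalMeasure (c / 2) := by
    have heq : (∫ x, g x * ∫ y, ρ y * logKernel x y ∂intervalMeasure (c / 2) ∂intervalMeasure (c / 2)) + ∫ x, g x * potential c x ∂intervalMeasure (c / 2) =
        ∫ x, g x * ((∫ y, ρ y * logKernel x y ∂intervalMeasure (c / 2)) + potential c x - l) ∂intervalMeasure (c / 2) := by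
      have e : ∀ x, g x * ((∫ y, ρ y * logKernel x y ∂intervalMeasure (c / 2)) + potential c x - l) =
          g x * (∫ y, ρ y * logKernel x y ∂intervalMeasure (c / 2)) + g x * potential c x - g x * l := fun x ↦ by ring
      simp only [e]
      have hsum : Integrable (fun x ↦ g x * (∫ y, ρ y * logKernel x y ∂intervalMeasure (c / 2)) +
          g x * potential c x) (intervalMeasure (c / 2)) := hPi.add hVg
      rw [integral_sub hsum (hgi.mul_const l), integral_add hPi hVg, integral_mul_const,
        hg0, zero_mul, sub_zero]
    rw [heq]
    refine integral_nonneg_of_ae ?_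
    have hσhalf : ∀ᵐ x ∂intervalMeasure (c / 2), σ x ≤ 1 / 2 := hσ.le_half
    filter_upwards [hσhalf, ae_intervalMeasure_abs_le (c / 2)] with x h1 h2
    obtain ⟨hle, heq⟩ := hl x h2
    rcases le_or_gt |x| (endpoint c) with hx | hx
    · rw [heq hx, sub_self, mul_zero]
      exact le_rfl
    -- Beyond the end point `ρ = 1/2`, hence `g ≤ 0` by the upper constraint on `σ`.
    · refine mul_nonneg_of_nonpos_of_nonpos ?_ (sub_nonpos.2 hle)
      simp only [hgdef, hρdef, arcsinDensity_eq_zero (endpoint_nonneg c) hx.le]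
      linarith
  rw [energy_eq (by linarith) hc₄ hρm hρM hρ1, energy_eq (by linarith) hc₄ hσm hσM hσ1, hadd, hVσ]
  linarith

theorem isTheMinimizer_half_sub_arcsinDensity {c : ℝ} (hc₂ : 2 ≤ c) (hc₄ : c ≤ 4) :
    IsTheMinimizer c fun x ↦ 1 / 2 - arcsinDensity (c / 2) (endpoint c) x := by
  have hadm := isAdmissible_half_sub_arcsinDensity hc₂ hc₄
  set ρ : ℝ → ℝ := fun x ↦ 1 / 2 - arcsinDensity (c / 2) (endpoint c) x with hρdef
  have hdiff : ∀ σ, IsAdmissible c σ →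
      AEStronglyMeasurable (fun x ↦ σ x - ρ x) (intervalMeasure (c / 2)) ∧
      (∀ᵐ x ∂intervalMeasure (c / 2), ‖σ x - ρ x‖ ≤ 1 / 2 + 1 / 2) ∧
      ∫ x, σ x - ρ x ∂intervalMeasure (c / 2) = 0 := fun σ hσ ↦ by
    have hρm : AEStronglyMeasurable ρ (intervalMeasure (c / 2)) :=
      hadm.aemeasurable.aestronglyMeasurable
    have hσm : AEStronglyMeasurable σ (intervalMeasure (c / 2)) :=
      hσ.aemeasurable.aestronglyMeasurable
    refine ⟨hσm.sub hρm, ?_, ?_⟩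
    · filter_upwards [hσ.norm_le, hadm.norm_le] with x h1 h2
      exact (norm_sub_le _ _).trans (add_le_add h1 h2)
    · rw [integral_sub (Integrable.of_bound hσm _ hσ.norm_le)
        (Integrable.of_bound hρm _ hadm.norm_le), sub_eq_zero]
      exact hσ.mass.trans hadm.mass.symm
  refine ⟨hadm, fun σ hσ ↦ ?_, fun σ hσ he ↦ ?_⟩
  · obtain ⟨h1, h2, h3⟩ := hdiff σ hσ
    have := logEnergy_nonneg (by linarith : 0 ≤ c / 2) (by linarith) h1 h2 h3
    linarith [energy_add_logEnergy_le hc₂ hc₄ hσ]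
  · obtain ⟨h1, h2, h3⟩ := hdiff σ hσ
    have hnn := logEnergy_nonneg (by linarith : 0 ≤ c / 2) (by linarith) h1 h2 h3
    have hle := energy_add_logEnergy_le hc₂ hc₄ hσ
    have hzero := ae_eq_zero_of_logEnergy_eq_zero (by linarith : 0 ≤ c / 2) (by linarith) h1 h2 h3
      (le_antisymm (by linarith) hnn)
    exact hzero.mono fun x hx ↦ sub_eq_zero.1 hx

end LimitDensity

end

/-! ### The main theorem, read off from the closed form -/

theorem mainTheorem4 (c : ℝ) (hc₂ : 2 ≤ c) (hc₄ : c ≤ 4) :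
    (∀ x : ℝ, |x| < LimitDensity.endpoint c →
      ∃ L : ℝ, LimitDensity.HasPrincipalValue
        (LimitDensity.integrand c x) (LimitDensity.endpoint c) x L) ∧
    LimitDensity.IsTheMinimizer c (fun x => 1 / 2 - LimitDensity.rhoOne c x) ∧
    (∀ x : ℝ, 0 ≤ LimitDensity.rhoOne c x) ∧
    Function.support (LimitDensity.rhoOne c) =
      Ioo (-(LimitDensity.endpoint c)) (LimitDensity.endpoint c) ∧
    IntegrableOn (LimitDensity.rhoOne c) (LimitDensity.domain c) ∧
    ∫ x in LimitDensity.domain c, LimitDensity.rhoOne c x = (c - 2) / 2 := by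
  refine ⟨fun x hx ↦ ⟨_, LimitDensity.hasPrincipalValue_integrand hc₂ hx⟩, ?_⟩
  rw [LimitDensity.rhoOne_eq hc₂]
  refine ⟨LimitDensity.isTheMinimizer_half_sub_arcsinDensity hc₂ hc₄,
    LimitDensity.arcsinDensity_nonneg _ _, ?_, LimitDensity.integrableOn_arcsinDensity _ _, ?_⟩
  · ext x
    rw [Function.mem_support, mem_Ioo, ← abs_lt]
    refine ⟨fun h ↦ ?_, fun h ↦ (LimitDensity.arcsinDensity_pos (LimitDensity.endpoint_le hc₂) h).ne'⟩
    by_contra hx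
    exact h (LimitDensity.arcsinDensity_eq_zero (LimitDensity.endpoint_nonneg c) (not_lt.1 hx))
  · rw [LimitDensity.domain, LimitDensity.integral_arcsinDensity (LimitDensity.endpoint_nonneg c)
      (LimitDensity.endpoint_le hc₂), LimitDensity.sqrt_sq_sub_endpoint_sq hc₂ hc₄]
    ring
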